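/- Let $\Gamma$ be a lattice in $\mathrm{SL}(2,\mathbb{R})$, that is, a discrete subgroup having a fundamental domain of finite Haar measure. Let $X=\Gamma\backslash \mathrm{SL}(2,\mathbb{R})=\{\Gamma x\}$ with its $\mathrm{SL}(2,\mathbb{R})$-invariant Borel probability measure $\mu$, and let $\eta_t(\Gamma x)=\Gamma x u^t$ be the horocycle flow on $X$, where $u^t=\begin{bmatrix}1&0\\t&1\end{bmatrix}$ for $t\in\mathbb{R}$. Let $(\Omega,\nu)$ be a standard Borel probability space with a jointly measurable, $\nu$-preserving flow $(\varphi_t)_{t\in\mathbb{R}}$, and suppose that $(\Omega,\nu)$ is nontrivial, that is, $\nu$ is not concentrated on a single point. Let $\psi\colon X\to\Omega$ be a quotient (factor) map, that is, a Borel map with $\psi_*\mu=\nu$ such that, for every $t\in\mathbb{R}$, $\psi(\eta_t(x))=\varphi_t(\psi(x))$ for $\mu$-almost every $x\in X$. Then $\psi$ has finite fibers almost everywhere: there is a conull Borel subset $X_0$ of $X$ such that $\psi^{-1}(\omega)\cap X_0$ is finite for every $\omega\in\Omega$. -/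

import Mathlib

open MeasureTheory
open scoped MatrixGroups

noncomputable section

namespace Horocycle

/-- The group `G = SL(2, ℝ)` of real `2 × 2` matrices of determinant one, with the topology
inherited from the space of matrices, carries its Borel `σ`-algebra. -/
instance instMeasurableSpaceSL : MeasurableSpace SL(2, ℝ) := borel _

instance instBorelSpaceSL : BorelSpace SL(2, ℝ) := ⟨rfl⟩

instance instLocallyCompactSpaceSL : LocallyCompactSpace SL(2, ℝ) :=
  haveI : LocallyCompactSpace (Matrix (Fin 2) (Fin 2) ℝ) :=
    inferInstanceAs (LocallyCompactSpace (Fin 2 → Fin 2 → ℝ))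
  Matrix.SpecialLinearGroup.isClosedEmbedding_val.locallyCompactSpace

/-- A subgroup `Γ` of `SL(2, ℝ)` is a lattice if it is discrete and has a fundamental domain (for
the action of `Γ` on `SL(2, ℝ)` by left multiplication) of finite Haar measure. -/
structure IsLattice (Γ : Subgroup SL(2, ℝ)) : Prop where
  discrete : DiscreteTopology Γ
  finite_covolume : ∃ F : Set SL(2, ℝ),
    IsFundamentalDomain Γ F (Measure.haar : Measure SL(2, ℝ)) ∧
      (Measure.haar : Measure SL(2, ℝ)) F < ⊤

/-- The space `Γ \ SL(2, ℝ)` of right cosets `Γ x`. -/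
def CosetSpace (Γ : Subgroup SL(2, ℝ)) : Type := Quotient (QuotientGroup.rightRel Γ)

/-- The quotient topology on `Γ \ SL(2, ℝ)`. -/
instance instTopologicalSpaceCosetSpace (Γ : Subgroup SL(2, ℝ)) :
    TopologicalSpace (CosetSpace Γ) :=
  inferInstanceAs (TopologicalSpace (Quotient (QuotientGroup.rightRel Γ)))

/-- The Borel `σ`-algebra of the quotient topology on `Γ \ SL(2, ℝ)`. -/
instance instMeasurableSpaceCosetSpace (Γ : Subgroup SL(2, ℝ)) :
    MeasurableSpace (CosetSpace Γ) := borel _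

instance instBorelSpaceCosetSpace (Γ : Subgroup SL(2, ℝ)) : BorelSpace (CosetSpace Γ) := ⟨rfl⟩

/-- The coset `Γ x`. -/
def coset (Γ : Subgroup SL(2, ℝ)) (x : SL(2, ℝ)) : CosetSpace Γ :=
  Quotient.mk (QuotientGroup.rightRel Γ) x

/-- The right translation `Γ x ↦ Γ x g` of `Γ \ SL(2, ℝ)`. -/
def rightTranslate (Γ : Subgroup SL(2, ℝ)) (g : SL(2, ℝ)) : CosetSpace Γ → CosetSpace Γ :=
  Quotient.map (fun x : SL(2, ℝ) => x * g) (by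
    intro x y h
    change QuotientGroup.rightRel Γ x y at h
    change QuotientGroup.rightRel Γ (x * g) (y * g)
    rw [QuotientGroup.rightRel_apply] at h ⊢
    simpa [mul_assoc] using h)

/-- The one-parameter unipotent subgroup `u ^ t`, the matrix with rows `(1, 0)` and `(t, 1)`. -/
def unip (t : ℝ) : SL(2, ℝ) := ⟨!![1, 0; t, 1], by simp [Matrix.det_fin_two]⟩

/-- The unipotent (horocycle) flow `η_t (Γ x) = Γ x u ^ t`. -/
def horocycleFlow (Γ : Subgroup SL(2, ℝ)) (t : ℝ) : CosetSpace Γ → CosetSpace Γ :=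
  rightTranslate Γ (unip t)

/-- `μ` is the Haar measure of `Γ \ SL(2, ℝ)`, that is, the probability measure on the Borel sets
of `Γ \ SL(2, ℝ)` that is invariant under right translation by every element of `SL(2, ℝ)`
(for a lattice `Γ`, there is exactly one). -/
structure IsHaarProbability (Γ : Subgroup SL(2, ℝ)) (μ : Measure (CosetSpace Γ)) : Prop where
  isProbabilityMeasure : IsProbabilityMeasure μ
  invariant : ∀ g : SL(2, ℝ), MeasurePreserving (rightTranslate Γ g) μ μ

/-- `φ` is a (measurable, measure-preserving) flow on the measure space `(Ω, ν)`. -/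
structure IsMeasurePreservingFlow {Ω : Type*} [MeasurableSpace Ω] (φ : ℝ → Ω → Ω)
    (ν : Measure Ω) : Prop where
  map_zero : φ 0 = id
  map_add : ∀ s t : ℝ, φ (s + t) = φ s ∘ φ t
  measurable : Measurable (fun p : ℝ × Ω => φ p.1 p.2)
  measurePreserving : ∀ t : ℝ, MeasurePreserving (φ t) ν ν

/-- `ψ` is a quotient map (factor map) from `(η, X, μ)` to `(φ, Ω, ν)`: it is a measure-preserving
measurable function that intertwines the flows almost everywhere. -/
structure IsQuotientMap {X Ω : Type*} [MeasurableSpace X] [MeasurableSpace Ω]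
    (η : ℝ → X → X) (μ : Measure X) (φ : ℝ → Ω → Ω) (ν : Measure Ω) (ψ : X → Ω) : Prop where
  measurePreserving : MeasurePreserving ψ μ ν
  equivariant : ∀ t : ℝ, ψ ∘ η t =ᵐ[μ] φ t ∘ ψ

/-- The space `(Ω, ν)` is trivial if it is a one-point space, up to a null set. -/
def IsTrivialSpace {Ω : Type*} [MeasurableSpace Ω] (ν : Measure Ω) : Prop :=
  ∃ ω₀ : Ω, ∀ᵐ ω ∂ν, ω = ω₀

/-- `ψ` has finite fibers almost everywhere: there is a conull set `X₀` that meets every fiber of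
`ψ` in a finite set. -/
def HasFiniteFibersAE {X Ω : Type*} [MeasurableSpace X] (μ : Measure X) (ψ : X → Ω) : Prop :=
  ∃ X₀ : Set X, MeasurableSet X₀ ∧ μ X₀ᶜ = 0 ∧ ∀ ω : Ω, (ψ ⁻¹' {ω} ∩ X₀).Finite

end Horocycle

end

/-! The argument is Ratner's shearing argument. Write `y = x g` for two points of one fiber with `g`
close to `1`. Then `η_t y = (η_t x)(u^{-t} g u^t)`, and the lower left entry of the conjugate is a
quadratic polynomial in `t`, while the other entries stay close to those of `1` until that
polynomial reaches absolute value one. So the orbits drift apart along the flow itself, and on a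
final proportion `c` of a long interval `[0, T]` one of them is almost exactly one unit of time
ahead of the other (`exists_shear`).

In a nontrivial factor the time-one map has almost no fixed points, because `η_1` is ergodic. Hence,
off a set `B` of measure less than `1/8`, no point near `η_1 x` has the same image as `x`
(`exists_small_set_of_ae_ne`). By the ergodic theorem both orbits mostly avoid `B` during the final
stretch, yet their images agree at almost all times: a contradiction
(`false_of_displacement_near_one`). If `g = u^s`, no drift occurs, but then `s` is a period of the
image point, and a multiple of `s` close to `1` gives the same contradiction.

Consequently a compact set `K` of positive measure meets each fiber in separated points, boundedly
many of them. Counting visits to `K` along orbits turns this bound into finiteness of almost all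
fibers (`hasFiniteFibersAE_of_card_le`). -/

namespace Horocycle

open Filter Set
open scoped Topology symmDiff

/-! ### Pointwise ergodic theorem via maximal Birkhoff sums -/

section Birkhoff

variable {X : Type*}

/-- The maximum of the Birkhoff sums of `f` of orders `0, …, n`. -/
def maxBirkhoffSum (T : X → X) (f : X → ℝ) : ℕ → X → ℝ
  | 0, _ => 0
  | n + 1, x => max 0 (f x + maxBirkhoffSum T f n (T x))

variable {T : X → X} {f : X → ℝ}

lemma maxBirkhoffSum_nonneg (n : ℕ) (x : X) : 0 ≤ maxBirkhoffSum T f n x := by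
  cases n with
  | zero => exact le_rfl
  | succ n => exact le_max_left _ _

lemma maxBirkhoffSum_le_succ (n : ℕ) (x : X) :
    maxBirkhoffSum T f n x ≤ maxBirkhoffSum T f (n + 1) x := by
  induction n generalizing x with
  | zero => exact maxBirkhoffSum_nonneg 1 x
  | succ n ih => exact max_le_max le_rfl (add_le_add le_rfl (ih (T x)))

lemma maxBirkhoffSum_mono (x : X) : Monotone fun n => maxBirkhoffSum T f n x :=
  monotone_nat_of_le_succ fun n => maxBirkhoffSum_le_succ n x

lemma birkhoffSum_le_maxBirkhoffSum (n : ℕ) (x : X) :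
    birkhoffSum T f n x ≤ maxBirkhoffSum T f n x := by
  induction n generalizing x with
  | zero => simp [maxBirkhoffSum]
  | succ n ih =>
    rw [birkhoffSum_succ']
    exact (add_le_add le_rfl (ih (T x))).trans (le_max_right _ _)

/-- The right side is dominated by `|f x|` and equals `f x` once the maximal sum at `T x` is large;
the maximal argument rests on these two facts. -/
lemma maxBirkhoffSum_succ_sub (n : ℕ) (x : X) :
    maxBirkhoffSum T f (n + 1) x - maxBirkhoffSum T f n (T x) =
      max (-maxBirkhoffSum T f n (T x)) (f x) := by
  rw [maxBirkhoffSum, ← max_sub_sub_right, zero_sub, add_sub_cancel_right]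

variable [MeasurableSpace X] {μ : Measure X}

lemma measurable_maxBirkhoffSum (hT : Measurable T) (hf : Measurable f) (n : ℕ) :
    Measurable (maxBirkhoffSum T f n) := by
  induction n with
  | zero => exact measurable_const
  | succ n ih => exact measurable_const.max (hf.add (ih.comp hT))

lemma integrable_maxBirkhoffSum [IsFiniteMeasure μ] (hT : MeasurePreserving T μ μ)
    (hf : Integrable f μ) (n : ℕ) : Integrable (maxBirkhoffSum T f n) μ := by
  induction n with
  | zero => exact integrable_zero _ _ _
  | succ n ih => exact (integrable_zero X ℝ μ).sup (hf.add (hT.integrable_comp_of_integrable ih))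

/-- The Birkhoff sums of a function with negative mean are almost surely bounded above. -/
theorem ae_exists_birkhoffSum_le [IsProbabilityMeasure μ] (hT : Ergodic T μ) (hfm : Measurable f)
    (hf : Integrable f μ) (hneg : ∫ x, f x ∂μ < 0) :
    ∀ᵐ x ∂μ, ∃ C, ∀ n, birkhoffSum T f n x ≤ C := by
  set M := maxBirkhoffSum T f with hM
  have hMm : ∀ n, Measurable (M n) := measurable_maxBirkhoffSum hT.measurable hfm
  set A : Set X := {x | ∃ C : ℕ, ∀ n, M n x ≤ C} with hA
  have hAm : MeasurableSet A := by
    have : A = ⋃ C : ℕ, ⋂ n, {x | M n x ≤ C} := by ext; simp [A]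
    rw [this]
    exact .iUnion fun C => .iInter fun n => measurableSet_le (hMm n) measurable_const
  have hmax (n : ℕ) (x : X) : M (n + 1) x - M n (T x) = max (-M n (T x)) (f x) :=
    maxBirkhoffSum_succ_sub n x
  have hM0 : ∀ n x, 0 ≤ M n x := maxBirkhoffSum_nonneg
  have hAinv : T ⁻¹' A = A := by
    ext x
    constructor
    · rintro ⟨C, hC⟩
      obtain ⟨C', hC'⟩ := exists_nat_ge (|f x| + C)
      refine ⟨C', fun n => (maxBirkhoffSum_le_succ n x).trans ?_⟩
      have := hmax n x
      have h2 : max (-M n (T x)) (f x) ≤ |f x| :=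
        max_le ((neg_nonpos.2 (hM0 _ _)).trans (abs_nonneg _)) (le_abs_self _)
      have := hC n
      change M (n + 1) x ≤ _
      linarith
    · rintro ⟨C, hC⟩
      obtain ⟨C', hC'⟩ := exists_nat_ge (|f x| + C)
      refine ⟨C', fun n => ?_⟩
      have := hmax n x
      have h2 := le_max_right (-M n (T x)) (f x)
      have := hC (n + 1)
      have := neg_abs_le (f x)
      linarith
  have hcompl : ∀ᵐ x ∂μ, x ∈ A := by
    rcases hT.toPreErgodic.ae_mem_or_ae_notMem hAm hAinv with h | h
    · exact h
    exfalso
    have hint (n : ℕ) : Integrable (M n) μ :=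
      integrable_maxBirkhoffSum hT.toMeasurePreserving hf n
    -- If the maximal sums are unbounded almost everywhere, these differences converge to `f`. Their
    -- integrals are nonnegative, since `T` preserves `μ` and `M n` increases with `n`, which
    -- contradicts the negative mean.
    have hlim : Tendsto (fun n => ∫ x, (M (n + 1) x - M n (T x)) ∂μ) atTop (𝓝 (∫ x, f x ∂μ)) := by
      refine tendsto_integral_of_dominated_convergence (fun x => |f x|) (fun n => ?_) hf.abs
        (fun n => .of_forall fun x => ?_) ?_
      · exact ((hMm _).sub ((hMm n).comp hT.measurable)).aestronglyMeasurable
      · rw [hmax, Real.norm_eq_abs, abs_le]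
        exact ⟨(neg_abs_le _).trans (le_max_right _ _),
          max_le ((neg_nonpos.2 (hM0 _ _)).trans (abs_nonneg _)) (le_abs_self _)⟩
      · filter_upwards [h] with x hx
        have hx' : T x ∉ A := fun h' => hx (hAinv ▸ h' : x ∈ A)
        refine tendsto_const_nhds.congr' ?_
        obtain ⟨C, hC⟩ := exists_nat_ge (-f x)
        have : ∃ n, (C : ℝ) < M n (T x) := by
          by_contra! hcon
          exact hx' ⟨C, hcon⟩
        obtain ⟨n, hn⟩ := this
        filter_upwards [eventually_ge_atTop n] with m hm
        rw [hmax, max_eq_right]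
        have : M n (T x) ≤ M m (T x) := maxBirkhoffSum_mono (T x) hm
        linarith
    refine hneg.not_ge (ge_of_tendsto' hlim fun n => ?_)
    have hint' : Integrable (fun x => M n (T x)) μ :=
      hT.toMeasurePreserving.integrable_comp_of_integrable (hint n)
    rw [integral_sub (hint _) hint', sub_nonneg]
    have : ∫ x, M n (T x) ∂μ = ∫ x, M n x ∂μ := by
      conv_rhs => rw [← hT.map_eq]
      exact (integral_map hT.measurable.aemeasurable (hMm n).aestronglyMeasurable).symm
    rw [this]
    exact integral_mono (hint n) (hint _) fun x => maxBirkhoffSum_le_succ n x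
  filter_upwards [hcompl] with x hx
  obtain ⟨C, hC⟩ := hx
  exact ⟨C, fun n => (birkhoffSum_le_maxBirkhoffSum n x).trans (hC n)⟩

lemma ae_eventually_birkhoffSum_le [IsProbabilityMeasure μ] (hT : Ergodic T μ)
    (hfm : Measurable f) (hf : Integrable f μ) {ε : ℝ} (hε : 0 < ε) :
    ∀ᵐ x ∂μ, ∀ᶠ n : ℕ in atTop, birkhoffSum T f n x ≤ (∫ x, f x ∂μ + ε) * n := by
  set c := ∫ x, f x ∂μ + ε / 2 with hc
  have key := ae_exists_birkhoffSum_le hT (hfm.sub_const c) (hf.sub (integrable_const c)) (by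
    rw [integral_sub hf (integrable_const c)]
    simp [hc]
    linarith)
  filter_upwards [key] with x ⟨C, hC⟩
  obtain ⟨m, hm⟩ := exists_nat_ge (C / (ε / 2))
  filter_upwards [eventually_ge_atTop m] with n hn
  have h1 := hC n
  have h2 : birkhoffSum T (fun x => f x - c) n x = birkhoffSum T f n x - n * c := by
    simp [birkhoffSum, Finset.sum_sub_distrib]
  rw [h2] at h1
  rw [div_le_iff₀ (by linarith)] at hm
  have h3 : (m : ℝ) ≤ n := by exact_mod_cast hn
  have h4 : (m : ℝ) * (ε / 2) ≤ n * (ε / 2) := by gcongr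
  have : (∫ x, f x ∂μ + ε) * n = n * c + n * (ε / 2) := by rw [hc]; ring
  linarith

/-- The pointwise ergodic theorem for an ergodic transformation. -/
theorem ae_eventually_abs_birkhoffSum_sub_le [IsProbabilityMeasure μ] (hT : Ergodic T μ)
    (hfm : Measurable f) (hf : Integrable f μ) {ε : ℝ} (hε : 0 < ε) :
    ∀ᵐ x ∂μ, ∀ᶠ n : ℕ in atTop, |birkhoffSum T f n x - (∫ x, f x ∂μ) * n| ≤ ε * n := by
  filter_upwards [ae_eventually_birkhoffSum_le hT hfm hf hε,
    ae_eventually_birkhoffSum_le hT hfm.neg hf.neg hε] with x h1 h2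
  filter_upwards [h1, h2] with n h3 h4
  have h5 : birkhoffSum T (-f) n x = -birkhoffSum T f n x := by simp [birkhoffSum]
  rw [h5] at h4
  simp only [Pi.neg_apply, integral_neg] at h4
  rw [abs_le]
  constructor <;> nlinarith

end Birkhoff

/-! ### Topology of the coset space and right translations -/

section Topology

instance instSecondCountableTopologySL : SecondCountableTopology SL(2, ℝ) :=
  haveI : SecondCountableTopology (Matrix (Fin 2) (Fin 2) ℝ) :=
    inferInstanceAs (SecondCountableTopology (Fin 2 → Fin 2 → ℝ))
  Matrix.SpecialLinearGroup.isClosedEmbedding_val.isEmbedding.secondCountableTopology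

instance instT2SpaceSL : T2Space SL(2, ℝ) :=
  haveI : T2Space (Matrix (Fin 2) (Fin 2) ℝ) := inferInstance
  Matrix.SpecialLinearGroup.isClosedEmbedding_val.isEmbedding.t2Space

variable (Γ : Subgroup SL(2, ℝ))

lemma isOpenQuotientMap_coset : IsOpenQuotientMap (coset Γ) :=
  MulAction.isOpenQuotientMap_quotientMk (Γ := Γ) (T := SL(2, ℝ))

instance instSecondCountableTopologyCosetSpace : SecondCountableTopology (CosetSpace Γ) :=
  ContinuousConstSMul.secondCountableTopology (Γ := Γ) (T := SL(2, ℝ))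

instance instLocallyCompactSpaceCosetSpace : LocallyCompactSpace (CosetSpace Γ) :=
  (isOpenQuotientMap_coset Γ).locallyCompactSpace

lemma t2Space_cosetSpace (hΓ : DiscreteTopology Γ) : T2Space (CosetSpace Γ) := by
  have : ProperlyDiscontinuousSMul Γ SL(2, ℝ) :=
    Γ.properlyDiscontinuousSMul_of_tendsto_cofinite
      (by
        let := IsTopologicalGroup.rightUniformSpace SL(2, ℝ)
        exact Γ.tendsto_coe_cofinite_of_discrete (isDiscrete_iff_discreteTopology.2 hΓ))
  exact t2Space_of_properlyDiscontinuousSMul_of_t2Space (Γ := Γ) (T := SL(2, ℝ))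

variable {Γ}

@[simp] lemma rightTranslate_coset (g x : SL(2, ℝ)) :
    rightTranslate Γ g (coset Γ x) = coset Γ (x * g) := rfl

lemma coset_surjective : Function.Surjective (coset Γ) := (isOpenQuotientMap_coset Γ).surjective

lemma rightTranslate_mul (g h : SL(2, ℝ)) (x : CosetSpace Γ) :
    rightTranslate Γ (g * h) x = rightTranslate Γ h (rightTranslate Γ g x) := by
  obtain ⟨x, rfl⟩ := coset_surjective x
  simp [mul_assoc]

@[simp] lemma rightTranslate_one (x : CosetSpace Γ) : rightTranslate Γ 1 x = x := by
  obtain ⟨x, rfl⟩ := coset_surjective x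
  simp

lemma rightTranslate_injective (g : SL(2, ℝ)) : Function.Injective (rightTranslate Γ g) :=
  Function.LeftInverse.injective (g := rightTranslate Γ g⁻¹) fun x => by
    rw [← rightTranslate_mul, mul_inv_cancel, rightTranslate_one]

lemma exists_rightTranslate_eq (x y : CosetSpace Γ) : ∃ g, rightTranslate Γ g x = y := by
  obtain ⟨x, rfl⟩ := coset_surjective x
  obtain ⟨y, rfl⟩ := coset_surjective y
  exact ⟨x⁻¹ * y, by simp⟩

lemma continuous_rightTranslate_uncurry :
    Continuous fun p : CosetSpace Γ × SL(2, ℝ) => rightTranslate Γ p.2 p.1 := by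
  have hq : IsOpenQuotientMap (Prod.map (coset Γ) (id : SL(2, ℝ) → SL(2, ℝ))) :=
    (isOpenQuotientMap_coset Γ).prodMap .id
  rw [hq.isQuotientMap.continuous_iff]
  exact (isOpenQuotientMap_coset Γ).continuous.comp continuous_mul

lemma continuous_unip : Continuous unip := by
  refine Continuous.subtype_mk ?_ _
  refine continuous_matrix fun i j => ?_
  fin_cases i <;> fin_cases j <;> simp <;> fun_prop

lemma unip_add (s t : ℝ) : unip (s + t) = unip s * unip t := by
  apply Subtype.ext
  rw [Matrix.SpecialLinearGroup.coe_mul]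
  simp [unip]

@[simp] lemma unip_zero : unip 0 = 1 := by
  ext i j
  fin_cases i <;> fin_cases j <;> simp [unip]

lemma horocycleFlow_add (s t : ℝ) (x : CosetSpace Γ) :
    horocycleFlow Γ (s + t) x = horocycleFlow Γ t (horocycleFlow Γ s x) := by
  rw [horocycleFlow, unip_add, rightTranslate_mul]; rfl

lemma continuous_horocycleFlow_uncurry :
    Continuous fun p : CosetSpace Γ × ℝ => horocycleFlow Γ p.2 p.1 :=
  continuous_rightTranslate_uncurry.comp
    (continuous_fst.prodMk (continuous_unip.comp continuous_snd))

lemma iterate_horocycleFlow_one (n : ℕ) (x : CosetSpace Γ) :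
    (horocycleFlow Γ 1)^[n] x = horocycleFlow Γ n x := by
  induction n with
  | zero => simp [horocycleFlow]
  | succ n ih => rw [Function.iterate_succ_apply', ih, ← horocycleFlow_add, Nat.cast_succ]

/-- A continuous function varies little on a compact set under small right translations. -/
lemma exists_nhds_one_abs_sub_lt {K : Set (CosetSpace Γ)} (hK : IsCompact K)
    {h : CosetSpace Γ → ℝ} (hh : Continuous h) {ε : ℝ} (hε : 0 < ε) :
    ∃ V ∈ 𝓝 (1 : SL(2, ℝ)), ∀ x ∈ K, ∀ g ∈ V, |h (rightTranslate Γ g x) - h x| < ε := by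
  have hopen : IsOpen {p : CosetSpace Γ × SL(2, ℝ) | |h (rightTranslate Γ p.2 p.1) - h p.1| < ε} :=
    isOpen_lt ((hh.comp continuous_rightTranslate_uncurry).sub
      (hh.comp continuous_fst)).abs continuous_const
  obtain ⟨U, V, -, hV, hKU, h1V, hsub⟩ :=
    generalized_tube_lemma hK (isCompact_singleton (x := (1 : SL(2, ℝ)))) hopen (by
      rintro ⟨x, g⟩ ⟨-, rfl : g = 1⟩
      simpa using hε)
  exact ⟨V, hV.mem_nhds (h1V rfl), fun x hx g hg => hsub (⟨hKU hx, hg⟩ : (x, g) ∈ U ×ˢ V)⟩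

/-- A subset of a compact set no two distinct points of which differ by a right translation close
to the identity has a bounded number of points. -/
lemma exists_card_le_of_separated {K : Set (CosetSpace Γ)} (hK : IsCompact K)
    {W : Set SL(2, ℝ)} (hW : W ∈ 𝓝 1) :
    ∃ N : ℕ, ∀ F : Finset (CosetSpace Γ), ↑F ⊆ K →
      (∀ x ∈ F, ∀ g ∈ W, rightTranslate Γ g x ∈ F → rightTranslate Γ g x = x) → F.card ≤ N := by
  obtain ⟨V, hV, hVW⟩ : ∃ V ∈ 𝓝 (1 : SL(2, ℝ)), ∀ a ∈ V, ∀ b ∈ V, a⁻¹ * b ∈ W := by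
    obtain ⟨V, hV, hsub⟩ := exists_nhds_split_inv hW
    refine ⟨V⁻¹, inv_mem_nhds_one _ hV, fun a ha b hb => ?_⟩
    simpa only [div_inv_eq_mul] using hsub a⁻¹ ha b⁻¹ hb
  have hnhds (x : CosetSpace Γ) : (fun g => rightTranslate Γ g x) '' V ∈ 𝓝 x := by
    obtain ⟨x, rfl⟩ := coset_surjective x
    have h1 : (fun g => x * g) '' V ∈ 𝓝 x := by
      have := (Homeomorph.mulLeft x).isOpenMap.image_mem_nhds hV
      simpa only [Homeomorph.coe_mulLeft, mul_one] using this
    have := (isOpenQuotientMap_coset Γ).isOpenMap.image_mem_nhds h1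
    rwa [image_image] at this
  -- Two points of `F` in the same patch `y V` differ by an element of `V⁻¹ V ⊆ W`, so each patch
  -- contains at most one.
  obtain ⟨t, -, ht⟩ := hK.elim_nhds_subcover _ fun x _ => hnhds x
  refine ⟨t.card, fun F hFK hF => ?_⟩
  have hcover : ∀ x ∈ F, ∃ y ∈ t, ∃ g ∈ V, rightTranslate Γ g y = x := by
    intro x hx
    simpa using ht (hFK hx)
  have : Nonempty (CosetSpace Γ) := ⟨coset Γ 1⟩
  choose! c hc g hg hgc using hcover
  refine Finset.card_le_card_of_injOn c (fun x hx => hc x hx) fun x hx y hy hxy => ?_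
  have hyx : rightTranslate Γ ((g x)⁻¹ * g y) x = y := by
    calc rightTranslate Γ ((g x)⁻¹ * g y) x
        = rightTranslate Γ ((g x)⁻¹ * g y) (rightTranslate Γ (g x) (c x)) := by rw [hgc x hx]
      _ = y := by rw [← rightTranslate_mul, mul_inv_cancel_left, hxy, hgc y hy]
  have := hF x hx _ (hVW _ (hg x hx) _ (hg y hy)) (hyx.symm ▸ hy)
  exact (this.symm.trans hyx)

end Topology

/-! ### Mautner phenomenon for length functions -/

section Mautner

/-- The upper unipotent matrix with rows `(1, b)` and `(0, 1)`. -/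
def upperUnip (b : ℝ) : SL(2, ℝ) := ⟨!![1, b; 0, 1], by simp [Matrix.det_fin_two]⟩

/-- The diagonal matrix with entries `2` and `1 / 2`. -/
noncomputable def diagTwo : SL(2, ℝ) := ⟨!![2, 0; 0, 1 / 2], by simp [Matrix.det_fin_two]⟩

lemma continuous_upperUnip : Continuous upperUnip := by
  refine Continuous.subtype_mk ?_ _
  refine continuous_matrix fun i j => ?_
  fin_cases i <;> fin_cases j <;> simp <;> fun_prop

@[simp] lemma upperUnip_zero : upperUnip 0 = 1 := by
  ext i j
  fin_cases i <;> fin_cases j <;> simp [upperUnip]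

/-- As `k → ∞` both upper unipotent factors tend to `1`, so `diagTwo` is a limit of elements of the
double cosets of powers of `u`. -/
lemma upperUnip_mul_unip (k : ℝ) (hk : k ≠ 0) :
    upperUnip (1 / (2 * k)) * unip (2 * k) = unip k * (diagTwo * upperUnip (1 / (4 * k))) := by
  apply Subtype.ext
  simp only [Matrix.SpecialLinearGroup.coe_mul]
  ext i j
  fin_cases i <;> fin_cases j <;>
    simp [upperUnip, unip, diagTwo, Matrix.mul_apply, Fin.sum_univ_two] <;> field_simp <;> norm_num

lemma diagTwo_mul_unip (c : ℝ) : diagTwo * unip c = unip (c / 4) * diagTwo := by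
  apply Subtype.ext
  simp only [Matrix.SpecialLinearGroup.coe_mul]
  ext i j
  fin_cases i <;> fin_cases j <;>
    simp [unip, diagTwo, Matrix.mul_apply, Fin.sum_univ_two]
  ring

lemma diagTwo_mul_upperUnip (b : ℝ) : diagTwo * upperUnip (b / 4) = upperUnip b * diagTwo := by
  apply Subtype.ext
  simp only [Matrix.SpecialLinearGroup.coe_mul]
  ext i j
  fin_cases i <;> fin_cases j <;>
    simp [upperUnip, diagTwo, Matrix.mul_apply, Fin.sum_univ_two]
  ring

lemma eq_upperUnip_mul_unip_mul_upperUnip (g : SL(2, ℝ)) (hg : g 1 0 ≠ 0) :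
    g = upperUnip ((g 0 0 - 1) / g 1 0) * unip (g 1 0) * upperUnip ((g 1 1 - 1) / g 1 0) := by
  have hdet := g.det_coe
  rw [Matrix.det_fin_two] at hdet
  apply Subtype.ext
  simp only [Matrix.SpecialLinearGroup.coe_mul]
  ext i j
  fin_cases i <;> fin_cases j <;>
    simp [upperUnip, unip, Matrix.mul_apply, Fin.sum_univ_two] <;> field_simp <;> linarith

/-- A continuous length function on `SL(2, ℝ)` that vanishes at `u ^ 1` vanishes identically. -/
theorem length_eq_zero {ρ : SL(2, ℝ) → ENNReal} (hmul : ∀ g h, ρ (g * h) ≤ ρ g + ρ h)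
    (hinv : ∀ g, ρ g⁻¹ ≤ ρ g) (hcont : Tendsto ρ (𝓝 1) (𝓝 0)) (hu : ρ (unip 1) = 0)
    (g : SL(2, ℝ)) : ρ g = 0 := by
  have hmul_left {a g : SL(2, ℝ)} (ha : ρ a = 0) : ρ (a * g) ≤ ρ g := by
    simpa [ha] using hmul a g
  have hmul_right {a g : SL(2, ℝ)} (ha : ρ a = 0) : ρ (g * a) ≤ ρ g := by
    simpa [ha] using hmul g a
  have hinv0 {a : SL(2, ℝ)} (ha : ρ a = 0) : ρ a⁻¹ = 0 := le_antisymm (ha ▸ hinv a) zero_le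
  have hone : ρ 1 = 0 := by
    refine le_antisymm ?_ zero_le
    rw [← mul_inv_cancel (unip 1)]
    exact (hmul_left hu).trans (hinv0 hu).le
  have hnat (n : ℕ) : ρ (unip n) = 0 := by
    induction n with
    | zero => simpa using hone
    | succ n ih =>
      rw [Nat.cast_succ, unip_add]
      exact le_antisymm ((hmul_left ih).trans hu.le) zero_le
  have hlim {s : ℕ → SL(2, ℝ)} (hs : Tendsto s atTop (𝓝 1)) :
      Tendsto (fun n => ρ (s n)) atTop (𝓝 0) := hcont.comp hs
  have hupper (c : ℝ) (hc : 0 < c) :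
      Tendsto (fun n : ℕ => upperUnip (1 / (c * n))) atTop (𝓝 1) := by
    refine (continuous_upperUnip.tendsto' 0 1 upperUnip_zero).comp ?_
    simp only [one_div]
    exact (tendsto_natCast_atTop_atTop.const_mul_atTop hc).inv_tendsto_atTop
  have hdiag : ρ diagTwo = 0 := by
    have hsum := (hlim (hupper 2 two_pos)).add (hlim (hupper 4 four_pos))
    rw [add_zero] at hsum
    refine le_antisymm (ge_of_tendsto hsum ?_) zero_le
    filter_upwards [eventually_ne_atTop 0] with n hn
    have h1 : diagTwo = (unip n)⁻¹ * (upperUnip (1 / (2 * n)) * unip ((2 * n : ℕ) : ℝ)) *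
        (upperUnip (1 / (4 * n)))⁻¹ := by
      rw [Nat.cast_mul, Nat.cast_ofNat, upperUnip_mul_unip n (by exact_mod_cast hn),
        inv_mul_cancel_left, mul_inv_cancel_right]
    calc ρ diagTwo ≤ ρ ((unip n)⁻¹ * (upperUnip (1 / (2 * n)) * unip ((2 * n : ℕ) : ℝ))) +
          ρ (upperUnip (1 / (4 * n)))⁻¹ := by rw [h1]; exact hmul _ _
      _ ≤ _ := add_le_add ((hmul_left (hinv0 (hnat n))).trans (hmul_right (hnat _))) (hinv _)
  have hquarter (x : ℝ) : Tendsto (fun n : ℕ => x / 4 ^ n) atTop (𝓝 0) :=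
    tendsto_const_nhds.div_atTop (tendsto_pow_atTop_atTop_of_one_lt (by norm_num))
  -- Conjugating by `diagTwo`, now of length zero, shrinks the parameter by a factor `4` at no cost;
  -- continuity at `1` finishes.
  have hupper0 (b : ℝ) : ρ (upperUnip b) = 0 := by
    have hstep (b : ℝ) : ρ (upperUnip b) ≤ ρ (upperUnip (b / 4)) := by
      rw [← mul_inv_cancel_right (upperUnip b) diagTwo, ← diagTwo_mul_upperUnip]
      exact (hmul_right (hinv0 hdiag)).trans (hmul_left hdiag)
    have hiter (n : ℕ) : ρ (upperUnip b) ≤ ρ (upperUnip (b / 4 ^ n)) := by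
      induction n with
      | zero => simp
      | succ n ih => rw [pow_succ, ← div_div]; exact ih.trans (hstep _)
    exact le_antisymm (ge_of_tendsto'
      (hlim ((continuous_upperUnip.tendsto' 0 1 upperUnip_zero).comp (hquarter b))) hiter) zero_le
  have hunip0 (c : ℝ) : ρ (unip c) = 0 := by
    have hstep (c : ℝ) : ρ (unip c) ≤ ρ (unip (c / 4)) := by
      rw [← inv_mul_cancel_left diagTwo (unip c), diagTwo_mul_unip]
      exact (hmul_left (hinv0 hdiag)).trans (hmul_right hdiag)
    have hiter (n : ℕ) : ρ (unip c) ≤ ρ (unip (c / 4 ^ n)) := by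
      induction n with
      | zero => simp
      | succ n ih => rw [pow_succ, ← div_div]; exact ih.trans (hstep _)
    exact le_antisymm (ge_of_tendsto'
      (hlim ((continuous_unip.tendsto' 0 1 unip_zero).comp (hquarter c))) hiter) zero_le
  have hbig (g : SL(2, ℝ)) (hg : g 1 0 ≠ 0) : ρ g = 0 := by
    rw [eq_upperUnip_mul_unip_mul_upperUnip g hg]
    exact le_antisymm ((hmul_right (hupper0 _)).trans ((hmul_left (hupper0 _)).trans
      (hunip0 _).le)) zero_le
  by_cases hg : g 1 0 = 0
  · have h1 : (g * unip 1) 1 0 ≠ 0 := by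
      have hdet := g.det_coe
      rw [Matrix.det_fin_two, hg, mul_zero, sub_zero] at hdet
      have : (g * unip 1) 1 0 = g 1 1 := by
        simp only [Matrix.SpecialLinearGroup.coe_mul]
        simp [unip, Matrix.mul_apply, Fin.sum_univ_two, hg]
      rw [this]
      rintro h
      simp [h] at hdet
    rw [← mul_inv_cancel_right g (unip 1)]
    exact le_antisymm ((hmul_right (hinv0 hu)).trans (hbig _ h1).le) zero_le
  · exact hbig g hg

end Mautner

/-! ### Ergodicity of the time-one map -/

section Ergodicity

variable {Γ : Subgroup SL(2, ℝ)} {μ : Measure (CosetSpace Γ)}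

lemma regular_of_isHaarProbability (hΓ : DiscreteTopology Γ) (hμ : IsHaarProbability Γ μ) :
    μ.Regular := by
  have := hμ.isProbabilityMeasure
  have := t2Space_cosetSpace Γ hΓ
  let := TopologicalSpace.metrizableSpaceMetric (CosetSpace Γ)
  infer_instance

/-- A set that is almost invariant under every right translation is null or conull. -/
lemma ae_mem_or_ae_notMem_of_rightTranslate (hμ : IsHaarProbability Γ μ)
    {A : Set (CosetSpace Γ)} (hA : MeasurableSet A)
    (h : ∀ g, rightTranslate Γ g ⁻¹' A =ᵐ[μ] A) : (∀ᵐ x ∂μ, x ∈ A) ∨ ∀ᵐ x ∂μ, x ∉ A := by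
  have := hμ.isProbabilityMeasure
  let m : Measure SL(2, ℝ) := Measure.haar
  have hmeas : MeasurableSet {p : CosetSpace Γ × SL(2, ℝ) | rightTranslate Γ p.2 p.1 ∈ A ↔
      p.1 ∈ A} := by
    have h1 : MeasurableSet ((fun p : CosetSpace Γ × SL(2, ℝ) => rightTranslate Γ p.2 p.1) ⁻¹' A) :=
      continuous_rightTranslate_uncurry.measurable hA
    exact h1.iff (measurable_fst hA)
  have hae : ∀ᵐ x ∂μ, ∀ᵐ g ∂m, rightTranslate Γ g x ∈ A ↔ x ∈ A := by
    rw [Measure.ae_ae_comm (μ := μ) (ν := m) hmeas]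
    refine .of_forall fun g => ?_
    filter_upwards [h g] with x hx
    exact iff_of_eq hx
  -- Take generic `x ∉ A` and `y = x k ∈ A`. For almost every `g` the point `x (k g) = y g` would
  -- lie both outside and inside `A`; left invariance of Haar measure allows `k g` in place of `g`.
  by_contra! hcon
  obtain ⟨x, hx, hxA⟩ := (hae.and_frequently hcon.1).exists
  obtain ⟨y, hy, hyA⟩ := (hae.and_frequently hcon.2).exists
  obtain ⟨k, hk⟩ := exists_rightTranslate_eq x y
  have hx' : ∀ᵐ g ∂m, rightTranslate Γ (k * g) x ∉ A := by
    filter_upwards [(measurePreserving_mul_left m k).quasiMeasurePreserving.ae hx] with g hg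
    rwa [hg]
  obtain ⟨g, h1, h2⟩ := (hx'.and hy).exists
  rw [rightTranslate_mul, hk, h2] at h1
  exact h1 hyA

/-- The time-one map of the horocycle flow is ergodic. -/
theorem ergodic_horocycleFlow_one (hΓ : DiscreteTopology Γ) (hμ : IsHaarProbability Γ μ) :
    Ergodic (horocycleFlow Γ 1) μ := by
  have := hμ.isProbabilityMeasure
  have := t2Space_cosetSpace Γ hΓ
  have := regular_of_isHaarProbability hΓ hμ
  refine ⟨hμ.invariant _, ⟨fun A hA hinv => ?_⟩⟩
  have hmp := hμ.invariant
  -- This is a length function because translations preserve `μ`, it is continuous at `1` because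
  -- `μ` is regular, and it vanishes at `u^1` because `A` is invariant.
  set ρ : SL(2, ℝ) → ENNReal := fun g => μ ((rightTranslate Γ g ⁻¹' A) ∆ A) with hρ
  have hpre (g h : SL(2, ℝ)) : rightTranslate Γ (g * h) ⁻¹' A =
      rightTranslate Γ g ⁻¹' (rightTranslate Γ h ⁻¹' A) := by
    ext x
    simp only [mem_preimage, rightTranslate_mul]
  have hone : rightTranslate Γ 1 ⁻¹' A = A := by ext x; simp
  have hm (g) : MeasurableSet (rightTranslate Γ g ⁻¹' A) := (hmp g).measurable hA
  have hzero : ∀ g, ρ g = 0 := by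
    refine length_eq_zero (fun g h => ?_) (fun g => ?_) ?_ ?_
    · calc ρ (g * h) ≤ μ ((rightTranslate Γ (g * h) ⁻¹' A) ∆ (rightTranslate Γ g ⁻¹' A)) + ρ g :=
            measure_symmDiff_le _ _ _
        _ = ρ h + ρ g := by
            rw [hpre, ← preimage_symmDiff,
              (hmp g).measure_preimage ((hm h).symmDiff hA).nullMeasurableSet]
        _ = ρ g + ρ h := add_comm _ _
    · refine le_of_eq ?_
      rw [hρ]
      simp only
      rw [← (hmp g).measure_preimage ((hm g⁻¹).symmDiff hA).nullMeasurableSet, preimage_symmDiff,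
        ← hpre, mul_inv_cancel, hone, symmDiff_comm]
    · let F : C(SL(2, ℝ) × CosetSpace Γ, CosetSpace Γ) :=
        ⟨fun p => rightTranslate Γ p.1 p.2,
          continuous_rightTranslate_uncurry.comp continuous_swap⟩
      have := tendsto_measure_symmDiff_preimage_nhds_zero (μ := μ) (ν := μ) (s := A)
        (F.curry.continuous.tendsto 1) (.of_forall hmp) (hmp 1) hA.nullMeasurableSet
        (measure_ne_top _ _)
      convert! this using 3 with g
      exact congrArg _ hone.symm
    · rw [hρ]
      simp only
      change μ ((horocycleFlow Γ 1 ⁻¹' A) ∆ A) = 0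
      rw [hinv, symmDiff_self]
      exact measure_empty
  rw [eventuallyConst_set]
  exact ae_mem_or_ae_notMem_of_rightTranslate hμ hA fun g =>
    measure_symmDiff_eq_zero_iff.1 (hzero g)

end Ergodicity

/-! ### Shearing: polynomial divergence of nearby orbits -/

section Shearing

/-- Bounds on the coefficients of a quadratic polynomial that is bounded on `[0, T]`. -/
lemma quadratic_coeff_bounds {c γ b T : ℝ} (hT : 0 < T)
    (h : ∀ t ∈ Icc 0 T, |c + γ * t - b * t ^ 2| ≤ 1) : |b| * T ^ 2 ≤ 8 ∧ |γ| * T ≤ 8 := by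
  -- With `p` the polynomial, `-b T² = 2 p(0) - 4 p(T/2) + 2 p(T)` and `γ T = 4 p(T/2) - p(T) - 3
  -- p(0)`.
  have h0 := abs_le.1 (h 0 ⟨le_rfl, hT.le⟩)
  have h1 := abs_le.1 (h (T / 2) ⟨by linarith, by linarith⟩)
  have h2 := abs_le.1 (h T ⟨hT.le, le_rfl⟩)
  constructor
  · rw [← abs_of_pos (pow_pos hT 2), ← abs_mul, abs_le]
    constructor <;> nlinarith
  · rw [← abs_of_pos hT, ← abs_mul, abs_le]
    constructor <;> nlinarith

/-- The first time at which a nonconstant quadratic polynomial has absolute value one. -/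
lemma exists_first_abs_quadratic_eq_one {c γ b : ℝ} (hc : |c| < 1) (h : γ ≠ 0 ∨ b ≠ 0) :
    ∃ T > 0, |c + γ * T - b * T ^ 2| = 1 ∧ ∀ t ∈ Icc 0 T, |c + γ * t - b * t ^ 2| ≤ 1 := by
  have hcont : Continuous fun t : ℝ => |c + γ * t - b * t ^ 2| := by fun_prop
  set S : Set ℝ := {t | 0 ≤ t ∧ 1 ≤ |c + γ * t - b * t ^ 2|} with hS
  have hSc : IsClosed S := isClosed_Ici.inter (isClosed_le continuous_const hcont)
  have hSb : BddBelow S := ⟨0, fun t ht => ht.1⟩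
  have hSne : S.Nonempty := by
    by_contra! hemp
    have hle : ∀ t, 0 ≤ t → |c + γ * t - b * t ^ 2| ≤ 1 := by
      intro t ht
      by_contra! hlt
      exact (hemp ▸ (⟨ht, hlt.le⟩ : t ∈ S) : t ∈ (∅ : Set ℝ))
    have hb (T : ℝ) (hT : 0 < T) := quadratic_coeff_bounds hT fun t ht => hle t ht.1
    rcases h with h | h
    · have hpos := abs_pos.2 h
      have := (hb (9 / |γ|) (by positivity)).2
      rw [mul_div_cancel₀ _ hpos.ne'] at this
      norm_num at this
    · have hpos := abs_pos.2 h
      have := (hb (1 + 9 / |b|) (by positivity)).1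
      have h9 : |b| * (9 / |b|) = 9 := mul_div_cancel₀ _ hpos.ne'
      have : 0 < 9 / |b| := by positivity
      nlinarith
  set T := sInf S
  have hTS : T ∈ S := hSc.csInf_mem hSne hSb
  have hlt : ∀ t, 0 ≤ t → t < T → |c + γ * t - b * t ^ 2| < 1 := by
    intro t h0 ht
    by_contra! hge
    exact (csInf_le hSb ⟨h0, hge⟩).not_gt ht
  have hTpos : 0 < T := by
    refine lt_of_le_of_ne hTS.1 fun h0 => ?_
    have := hTS.2
    rw [← h0] at this
    simp at this
    linarith
  have hTeq : |c + γ * T - b * T ^ 2| = 1 := by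
    obtain ⟨t, ht, heq⟩ := intermediate_value_Icc hTS.1 hcont.continuousOn
      (⟨by simpa using hc.le, hTS.2⟩ : (1 : ℝ) ∈ Icc _ _)
    have : T ≤ t := csInf_le hSb ⟨ht.1, heq.ge⟩
    rwa [le_antisymm ht.2 this] at heq
  refine ⟨T, hTpos, hTeq, fun t ht => ?_⟩
  rcases ht.2.lt_or_eq with h | h
  · exact (hlt t ht.1 h).le
  · rw [h, hTeq]

lemma exists_entry_ball_subset {V : Set SL(2, ℝ)} (hV : V ∈ 𝓝 1) :
    ∃ r > 0, ∀ g : SL(2, ℝ), |g 0 0 - 1| < r → |g 0 1| < r → |g 1 0| < r → |g 1 1 - 1| < r →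
      g ∈ V := by
  have hemb : Topology.IsEmbedding ((↑) : SL(2, ℝ) → Matrix (Fin 2) (Fin 2) ℝ) :=
    Matrix.SpecialLinearGroup.isClosedEmbedding_val.isEmbedding
  obtain ⟨U, hU, hUV⟩ := (hemb.nhds_eq_comap (1 : SL(2, ℝ))).ge hV
  change U ∈ @nhds (Fin 2 → Fin 2 → ℝ) _ _ at hU
  obtain ⟨r, hr, hball⟩ := Metric.mem_nhds_iff.1 hU
  refine ⟨r, hr, fun g h00 h01 h10 h11 => hUV (hball ?_)⟩
  refine (dist_pi_lt_iff hr).2 fun i => (dist_pi_lt_iff hr).2 fun j => ?_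
  fin_cases i <;> fin_cases j <;> simpa [Real.dist_eq]

lemma entry_ball_mem_nhds {r : ℝ} (hr : 0 < r) :
    {g : SL(2, ℝ) | |g 0 0 - 1| < r ∧ |g 0 1| < r ∧ |g 1 0| < r ∧ |g 1 1 - 1| < r} ∈
      𝓝 (1 : SL(2, ℝ)) := by
  have hc (i j) : Continuous fun g : SL(2, ℝ) => g i j := by
    have : Continuous fun g : SL(2, ℝ) => g i :=
      Matrix.SpecialLinearGroup.continuous_apply id continuous_id i
    exact (continuous_apply j).comp this
  refine IsOpen.mem_nhds ?_ (by simpa using hr)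
  exact (isOpen_lt ((hc 0 0).sub continuous_const).abs continuous_const).inter
    ((isOpen_lt (hc 0 1).abs continuous_const).inter
      ((isOpen_lt (hc 1 0).abs continuous_const).inter
        (isOpen_lt ((hc 1 1).sub continuous_const).abs continuous_const)))

lemma coe_unip_conj (g : SL(2, ℝ)) (t : ℝ) :
    (unip (-1) * (unip (-t) * g * unip t) : SL(2, ℝ)).1 =
      !![g 0 0 + g 0 1 * t, g 0 1;
        g 1 0 + (g 1 1 - g 0 0) * t - g 0 1 * t ^ 2 - (g 0 0 + g 0 1 * t),
        g 1 1 - g 0 1 * t - g 0 1] := by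
  rw [Matrix.SpecialLinearGroup.coe_mul, Matrix.SpecialLinearGroup.coe_mul,
    Matrix.SpecialLinearGroup.coe_mul, Matrix.eta_fin_two g.1]
  simp only [unip, Matrix.mul_fin_two]
  ext i j
  fin_cases i <;> fin_cases j <;> simp <;> ring

/-- If the displacement in the direction of the horocycle flow is close to one and the displacement
in the other directions is small, then the conjugate of `g` is close to `u ^ 1`. -/
lemma unip_conj_mem {V : Set SL(2, ℝ)} {r : ℝ}
    (hV : ∀ g : SL(2, ℝ), |g 0 0 - 1| < r → |g 0 1| < r → |g 1 0| < r → |g 1 1 - 1| < r → g ∈ V)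
    {g : SL(2, ℝ)} {t : ℝ} (h00 : |g 0 0 - 1| < r / 8) (h01 : |g 0 1| < r / 8)
    (h11 : |g 1 1 - 1| < r / 8) (ht : |g 0 1 * t| ≤ r / 8)
    (hp : |g 1 0 + (g 1 1 - g 0 0) * t - g 0 1 * t ^ 2 - 1| ≤ r / 4) :
    unip (-1) * (unip (-t) * g * unip t) ∈ V := by
  have h := coe_unip_conj g t
  rw [abs_lt] at h00 h01 h11
  rw [abs_le] at ht hp
  refine hV _ ?_ ?_ ?_ ?_ <;> rw [h] <;> simp [abs_lt] <;> constructor <;> linarith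

/-- The shearing property of the horocycle flow: nearby points that do not lie on the same orbit
drift apart in the direction of the flow, and the drift is close to one during a definite
proportion of some long interval of time. -/
theorem exists_shear {V : Set SL(2, ℝ)} (hV : V ∈ 𝓝 1) :
    ∃ c ∈ Ioo (0 : ℝ) 1, ∀ T₀ : ℝ, ∃ W ∈ 𝓝 (1 : SL(2, ℝ)), ∀ g ∈ W, g ≠ 1 →
      (∃ (s : ℝ) (k : ℤ), g = unip s ∧ k * s ∈ Icc (0 : ℝ) 2 ∧ unip (k * s - 1) ∈ V) ∨
      ∃ T ≥ T₀, (∀ t ∈ Icc ((1 - c) * T) T, unip (-1) * (unip (-t) * g * unip t) ∈ V) ∨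
        ∀ t ∈ Icc ((1 - c) * T) T, unip (-1) * (unip (-t) * g⁻¹ * unip t) ∈ V := by
  obtain ⟨r, hr, hball⟩ := exists_entry_ball_subset hV
  -- On `[(1 - c) T, T]` the drift changes by at most `c (8 + 2 · 8) = 24 c ≤ r / 4`.
  set c := min (r / 96) (1 / 2) with hcdef
  have hc0 : 0 < c := lt_min (by linarith) (by norm_num)
  have hc1 : c ≤ 1 / 2 := min_le_right _ _
  have hcr : c ≤ r / 96 := min_le_left _ _
  refine ⟨c, ⟨hc0, by linarith⟩, fun T₀ => ?_⟩
  -- The bound `64 / r` makes `|g 0 1| T ≤ 8 / T ≤ r / 8`, so the diagonal entries stay near `1`.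
  -- The choice of `w` keeps the polynomial at most `w (1 + T₁)² ≤ 1 / 2` up to time `T₁`, so it
  -- reaches one only later.
  set T₁ := max (max T₀ 1) (64 / r) with hT₁
  have hT₁1 : 1 ≤ T₁ := (le_max_right _ _).trans (le_max_left _ _)
  set w := min (min (r / 8) 1) (1 / (2 * (1 + T₁) ^ 2)) with hw
  have hw0 : 0 < w := by positivity
  have hwr : w ≤ r / 8 := (min_le_left _ _).trans (min_le_left _ _)
  have hw1 : w ≤ 1 := (min_le_left _ _).trans (min_le_right _ _)
  have hwT : w * (1 + T₁) ^ 2 ≤ 1 / 2 := by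
    calc w * (1 + T₁) ^ 2 ≤ 1 / (2 * (1 + T₁) ^ 2) * (1 + T₁) ^ 2 := by
          gcongr; exact min_le_right _ _
      _ = 1 / 2 := by field_simp
  refine ⟨_, entry_ball_mem_nhds hw0, fun g ⟨h00, h01, h10, h11⟩ hg1 => ?_⟩
  have hdet := g.det_coe
  rw [Matrix.det_fin_two] at hdet
  by_cases hdeg : g 1 1 - g 0 0 = 0 ∧ g 0 1 = 0
  · left
    obtain ⟨hd, hb⟩ := hdeg
    have ha : g 0 0 = 1 := by
      have hd' : g 1 1 = g 0 0 := by linarith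
      rw [hb, hd', zero_mul, sub_zero] at hdet
      have := (abs_lt.1 h00).1
      nlinarith
    have hgs : g = unip (g 1 0) := by
      ext i j
      fin_cases i <;> fin_cases j <;> simp [unip] <;> linarith
    set s := g 1 0 with hs
    have hs0 : s ≠ 0 := by
      intro h
      rw [h, unip_zero] at hgs
      exact hg1 hgs
    have hk : |round (1 / s) * s - 1| ≤ |s| / 2 := by
      have h1 := abs_sub_round (1 / s)
      have h2 : round (1 / s) * s - 1 = -(1 / s - round (1 / s)) * s := by field_simp; ring
      rw [h2, abs_mul, abs_neg]
      nlinarith [abs_nonneg s]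
    -- The multiple of `s` nearest to `1` is within `|s| / 2` of it.
    refine ⟨s, round (1 / s), hgs, ?_, hball _ ?_ ?_ ?_ ?_⟩
    · have := abs_le.1 hk
      constructor <;> linarith
    · simpa [unip] using hr
    · simpa [unip] using hr
    · have h1 : unip (round (1 / s) * s - 1) 1 0 = round (1 / s) * s - 1 := rfl
      rw [h1]
      linarith
    · simpa [unip] using hr
  · right
    have hne : g 1 1 - g 0 0 ≠ 0 ∨ g 0 1 ≠ 0 := by tauto
    obtain ⟨T, hT, hpT, hle⟩ := exists_first_abs_quadratic_eq_one (h10.trans_le hw1) hne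
    obtain ⟨hbT, hγT⟩ := quadratic_coeff_bounds hT hle
    have hTT₁ : T₁ ≤ T := by
      by_contra! hlt
      have hγ : |g 1 1 - g 0 0| ≤ 2 * w := by
        rw [abs_le]; rw [abs_lt] at h00 h11
        constructor <;> linarith
      have h1 : |g 1 0 + (g 1 1 - g 0 0) * T - g 0 1 * T ^ 2| ≤ w + 2 * w * T + w * T ^ 2 := by
        refine (abs_sub _ _).trans (add_le_add ((abs_add_le _ _).trans (add_le_add h10.le ?_)) ?_)
        · rw [abs_mul, abs_of_pos hT]; gcongr
        · rw [abs_mul, abs_of_pos (pow_pos hT 2)]; gcongr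
      have h2 : w * (1 + T) ^ 2 ≤ w * (1 + T₁) ^ 2 := by gcongr
      nlinarith
    have hTr : 64 / r ≤ T := (le_max_right _ _).trans hTT₁
    have hwin : ∀ t ∈ Icc ((1 - c) * T) T, |g 0 1 * t| ≤ r / 8 ∧
        |(g 1 0 + (g 1 1 - g 0 0) * t - g 0 1 * t ^ 2) -
          (g 1 0 + (g 1 1 - g 0 0) * T - g 0 1 * T ^ 2)| ≤ r / 4 := by
      rintro t ⟨ht1, ht2⟩
      have ht0 : 0 ≤ t := (mul_nonneg (by linarith) hT.le).trans ht1
      constructor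
      · rw [abs_mul, abs_of_nonneg ht0]
        have h1 : |g 0 1| * t ≤ |g 0 1| * T := by gcongr
        have h2 : 8 ≤ r / 8 * T := by
          rw [div_le_iff₀ hr] at hTr
          linarith
        have h3 : |g 0 1| * T * T ≤ r / 8 * T := by nlinarith
        exact h1.trans (le_of_mul_le_mul_right h3 hT)
      · have hfac : (g 1 0 + (g 1 1 - g 0 0) * t - g 0 1 * t ^ 2) -
          (g 1 0 + (g 1 1 - g 0 0) * T - g 0 1 * T ^ 2) =
            (t - T) * ((g 1 1 - g 0 0) - g 0 1 * (t + T)) := by ring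
        rw [hfac, abs_mul]
        have h1 : |t - T| ≤ c * T := by rw [abs_le]; constructor <;> nlinarith
        have h2 : |(g 1 1 - g 0 0) - g 0 1 * (t + T)| ≤ |g 1 1 - g 0 0| + |g 0 1| * (2 * T) := by
          refine (abs_sub _ _).trans (add_le_add le_rfl ?_)
          rw [abs_mul, abs_of_nonneg (by linarith : 0 ≤ t + T)]
          gcongr
          linarith
        calc _ ≤ c * T * (|g 1 1 - g 0 0| + |g 0 1| * (2 * T)) := by gcongr
          _ = c * (|g 1 1 - g 0 0| * T + 2 * (|g 0 1| * T ^ 2)) := by ring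
          _ ≤ c * (8 + 2 * 8) := by gcongr
          _ ≤ r / 4 := by linarith
    refine ⟨T, ((le_max_left _ _).trans (le_max_left _ _)).trans hTT₁, ?_⟩
    rcases (abs_eq one_pos.le).1 hpT with h | h
    · left
      intro t ht
      obtain ⟨h1, h2⟩ := hwin t ht
      rw [h] at h2
      exact unip_conj_mem hball (h00.trans_le hwr) (h01.trans_le hwr) (h11.trans_le hwr) h1 h2
    -- When the drift is `-1`, passing to `g⁻¹`, that is, exchanging the two points, negates the
    -- polynomial.
    · right
      intro t ht
      obtain ⟨h1, h2⟩ := hwin t ht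
      rw [h] at h2
      have e00 : g⁻¹ 0 0 = g 1 1 := by simp [Matrix.SpecialLinearGroup.SL2_inv_expl]
      have e01 : g⁻¹ 0 1 = -g 0 1 := by simp [Matrix.SpecialLinearGroup.SL2_inv_expl]
      have e10 : g⁻¹ 1 0 = -g 1 0 := by simp [Matrix.SpecialLinearGroup.SL2_inv_expl]
      have e11 : g⁻¹ 1 1 = g 0 0 := by simp [Matrix.SpecialLinearGroup.SL2_inv_expl]
      refine unip_conj_mem hball ?_ ?_ ?_ ?_ ?_
      · rw [e00]; exact h11.trans_le hwr
      · rw [e01, abs_neg]; exact h01.trans_le hwr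
      · rw [e11]; exact h00.trans_le hwr
      · rwa [e01, neg_mul, abs_neg]
      · rw [e00, e01, e10, e11, ← abs_neg]
        convert h2 using 2
        ring

end Shearing

/-! ### From bounded to finite fibers -/

section Counting

variable {X Ω : Type*} [MeasurableSpace X] {μ : Measure X} [IsProbabilityMeasure μ]

/-- If a set of positive measure meets each fiber of a factor map of an ergodic injective
transformation in a bounded number of points, then the factor map has finite fibers. -/
theorem hasFiniteFibersAE_of_card_le {T : X → X} (hT : Ergodic T μ) (hinj : Function.Injective T)
    {ψ : X → Ω} {S : Ω → Ω} (hψ : ψ ∘ T =ᵐ[μ] S ∘ ψ) {E : Set X} (hE : MeasurableSet E)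
    (hE0 : μ E ≠ 0) {N : ℕ}
    (hN : ∀ F : Finset X, ↑F ⊆ E → (∀ x ∈ F, ∀ y ∈ F, ψ x = ψ y) → F.card ≤ N) :
    HasFiniteFibersAE μ ψ := by
  classical
  set p := μ.real E
  have hp : 0 < p := ENNReal.toReal_pos hE0 (measure_ne_top _ _)
  set f : X → ℝ := E.indicator fun _ => 1
  have hfm : Measurable f := measurable_const.indicator hE
  have hfi : Integrable f μ := (integrable_const 1).indicator hE
  have hint : ∫ x, f x ∂μ = p := by simp [f, p, integral_indicator, hE]
  have hB := ae_eventually_abs_birkhoffSum_sub_le hT hfm hfi (half_pos hp)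
  have hiter : ∀ᵐ x ∂μ, ∀ n : ℕ, ψ (T^[n] x) = S^[n] (ψ x) := by
    have h1 : ∀ᵐ x ∂μ, ∀ n : ℕ, ψ (T (T^[n] x)) = S (ψ (T^[n] x)) :=
      ae_all_iff.2 fun n =>
        (hT.toMeasurePreserving.iterate n).quasiMeasurePreserving.ae hψ
    filter_upwards [h1] with x hx n
    induction n with
    | zero => rfl
    | succ n ih => rw [Function.iterate_succ_apply', Function.iterate_succ_apply', hx, ih]
  obtain ⟨X₀, hX₀, hX₀m, hX₀p⟩ := (hB.and hiter).exists_measurable_mem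
  refine ⟨X₀, hX₀m, mem_ae_iff.1 hX₀, fun ω => ?_⟩
  by_contra hinf
  -- Double counting over `n` steps: each of `M` points in one fiber visits `E` at least `p n / 2`
  -- times, but at each time at most `N` of their distinct images, again in one fiber, lie in `E`.
  -- So `M p / 2 ≤ N`.
  obtain ⟨M, hM⟩ := exists_nat_gt (2 * N / p)
  obtain ⟨F, hFsub, hFcard⟩ := Set.Infinite.exists_subset_card_eq hinf M
  have hev : ∀ᶠ n : ℕ in atTop, ∀ x ∈ F, |birkhoffSum T f n x - (∫ x, f x ∂μ) * n| ≤ p / 2 * n :=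
    (eventually_all_finset F).2 fun x hx => (hX₀p x (hFsub hx).2).1
  obtain ⟨n, hn, hn0⟩ := (hev.and (eventually_gt_atTop 0)).exists
  have hn0' : (0 : ℝ) < n := by exact_mod_cast hn0
  have hlow : M * (p / 2 * n) ≤ ∑ x ∈ F, birkhoffSum T f n x := by
    rw [← hFcard, ← nsmul_eq_mul]
    refine Finset.card_nsmul_le_sum _ _ _ fun x hx => ?_
    have := (abs_le.1 (hn x hx)).1
    rw [hint] at this
    linarith
  have hup : ∑ x ∈ F, birkhoffSum T f n x ≤ N * n := by
    simp only [birkhoffSum]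
    rw [Finset.sum_comm, mul_comm, ← nsmul_eq_mul]
    conv_rhs => rw [← Finset.card_range n]
    refine Finset.sum_le_card_nsmul _ _ _ fun k _ => ?_
    set F' := (F.filter fun x => T^[k] x ∈ E).image T^[k] with hF'
    have h1 : ∑ x ∈ F, f (T^[k] x) = F'.card := by
      rw [hF', Finset.card_image_of_injective _ (hinj.iterate k), Finset.card_filter]
      push_cast
      refine Finset.sum_congr rfl fun x _ => ?_
      simp [f, indicator_apply]
    rw [h1]
    have hω : ∀ y ∈ F', ψ y = S^[k] ω := by
      intro y hy
      obtain ⟨x, hx, rfl⟩ := Finset.mem_image.1 hy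
      have hxF := hFsub (Finset.mem_filter.1 hx).1
      rw [(hX₀p x hxF.2).2 k, hxF.1]
    exact_mod_cast hN F' (fun y hy => by
      obtain ⟨x, hx, rfl⟩ := Finset.mem_image.1 hy
      exact (Finset.mem_filter.1 hx).2) fun x hx y hy => (hω x hx).trans (hω y hy).symm
  rw [div_lt_iff₀ hp] at hM
  nlinarith

end Counting

/-! ### Separation of `x` from the points near `η_1 x` -/

section Factor

variable {Γ : Subgroup SL(2, ℝ)} {μ : Measure (CosetSpace Γ)}

/-- The time-one map of a nontrivial factor of the horocycle flow has almost no fixed points. -/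
lemma ae_apply_horocycleFlow_one_ne (hΓ : DiscreteTopology Γ) (hμ : IsHaarProbability Γ μ)
    {Ω : Type*} [MeasurableSpace Ω] [StandardBorelSpace Ω] {ν : Measure Ω}
    {φ : ℝ → Ω → Ω} (hφ : IsMeasurePreservingFlow φ ν) {ψ : CosetSpace Γ → Ω}
    (hψ : IsQuotientMap (horocycleFlow Γ) μ φ ν ψ) (hν : ¬ IsTrivialSpace ν) :
    ∀ᵐ x ∂μ, ψ (horocycleFlow Γ 1 x) ≠ ψ x := by
  have hT := ergodic_horocycleFlow_one hΓ hμ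
  have hφ1 : Measurable (φ 1) := (hφ.measurePreserving 1).measurable
  have hψm := hψ.measurePreserving.measurable
  have hinj : Function.Injective (φ 1) := by
    refine Function.LeftInverse.injective (g := φ (-1)) fun ω => ?_
    have := congrFun (hφ.map_add (-1) 1) ω
    rw [neg_add_cancel, hφ.map_zero] at this
    exact this.symm
  have hA : MeasurableSet {x | φ 1 (ψ x) = ψ x} := measurableSet_eq_fun (hφ1.comp hψm) hψm
  have hinv : horocycleFlow Γ 1 ⁻¹' {x | φ 1 (ψ x) = ψ x} =ᵐ[μ] {x | φ 1 (ψ x) = ψ x} := by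
    filter_upwards [hψ.equivariant 1] with x hx
    refine propext ?_
    change φ 1 (ψ (horocycleFlow Γ 1 x)) = ψ (horocycleFlow Γ 1 x) ↔ φ 1 (ψ x) = ψ x
    rw [Function.comp_apply, Function.comp_apply] at hx
    rw [hx, hinj.eq_iff]
  rcases hT.quasiErgodic.ae_mem_or_ae_notMem₀ hA.nullMeasurableSet hinv with h | h
  -- If almost every image is fixed, `ψ` is invariant under the ergodic time-one map, hence constant
  -- almost everywhere.
  · exfalso
    have : Nonempty Ω := ⟨ψ (coset Γ 1)⟩
    obtain ⟨ω₀, hω₀⟩ := hT.ae_eq_const_of_ae_eq_comp₀ hψm.nullMeasurable (by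
      filter_upwards [h, hψ.equivariant 1] with x hx hx'
      exact hx'.trans hx)
    refine hν ⟨ω₀, ?_⟩
    rw [← hψ.measurePreserving.map_eq]
    exact (ae_map_iff (p := fun ω => ω = ω₀) hψm.aemeasurable (measurableSet_singleton ω₀)).2 hω₀
  · filter_upwards [h, hψ.equivariant 1] with x hx hx'
    rw [Function.comp_apply, Function.comp_apply] at hx'
    rwa [hx']

lemma exists_pos_measureReal_le_lt {X : Type*} [MeasurableSpace X] {μ : Measure X}
    [IsFiniteMeasure μ] {D : X → ℝ} (hD : Measurable D) (hpos : ∀ᵐ x ∂μ, 0 < D x) {ε : ℝ}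
    (hε : 0 < ε) : ∃ δ > 0, μ.real {x | D x ≤ δ} < ε := by
  have h := tendsto_measure_iInter_atTop (μ := μ) (s := fun n : ℕ => {x | D x ≤ 1 / ((n : ℝ) + 1)})
    (fun n => (measurableSet_le hD measurable_const).nullMeasurableSet)
    (fun m n hmn x hx => le_trans (show D x ≤ _ from hx) (Nat.one_div_le_one_div hmn))
    ⟨0, measure_ne_top _ _⟩
  have h0 : μ (⋂ n : ℕ, {x | D x ≤ 1 / ((n : ℝ) + 1)}) = 0 := by
    refine measure_mono_null (fun x hx => ?_) (ae_iff.1 hpos)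
    rw [mem_iInter] at hx
    exact not_lt.2 (ge_of_tendsto' tendsto_one_div_add_atTop_nhds_zero_nat hx)
  rw [h0] at h
  obtain ⟨n, hn⟩ := (h.eventually (gt_mem_nhds (ENNReal.ofReal_pos.2 hε))).exists
  exact ⟨1 / ((n : ℝ) + 1), by positivity,
    (ENNReal.lt_ofReal_iff_toReal_lt (measure_ne_top _ _)).1 hn⟩

/-- A function that is almost nowhere invariant under the time-one map takes different values at
`x` and at all points close to the time-one image of `x`, outside a set of small measure. -/
theorem exists_small_set_of_ae_ne (hΓ : DiscreteTopology Γ) (hμ : IsHaarProbability Γ μ)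
    {f : CosetSpace Γ → ℝ} (hf : Measurable f) (hfi : Integrable f μ)
    (hne : ∀ᵐ x ∂μ, f (horocycleFlow Γ 1 x) ≠ f x) {ε : ℝ} (hε : 0 < ε) :
    ∃ B, MeasurableSet B ∧ μ.real B < ε ∧ ∃ V ∈ 𝓝 (1 : SL(2, ℝ)), ∀ x ∉ B, ∀ g ∈ V,
      rightTranslate Γ g (horocycleFlow Γ 1 x) ∉ B →
        f (rightTranslate Γ g (horocycleFlow Γ 1 x)) ≠ f x := by
  have := hμ.isProbabilityMeasure
  have := t2Space_cosetSpace Γ hΓ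
  have := regular_of_isHaarProbability hΓ hμ
  have hTmp : MeasurePreserving (horocycleFlow Γ 1) μ μ := hμ.invariant _
  have hε4 : 0 < ε / 4 := by linarith
  have hDm : Measurable fun x => |f (horocycleFlow Γ 1 x) - f x| :=
    ((hf.comp hTmp.measurable).sub hf).norm
  obtain ⟨δ, hδ, hDδ⟩ := exists_pos_measureReal_le_lt hDm (by
    filter_upwards [hne] with x hx
    exact abs_pos.2 (sub_ne_zero.2 hx)) hε4
  obtain ⟨h, -, hfh, hhc, hhi⟩ := hfi.exists_hasCompactSupport_integral_sub_le
    (ε := ε / 8 * (δ / 4)) (by positivity)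
  obtain ⟨K, -, hK, hKμ⟩ := MeasurableSet.univ.exists_isCompact_sdiff_lt (μ := μ)
    (measure_ne_top _ _) (ENNReal.ofReal_pos.2 (half_pos hε4)).ne'
  obtain ⟨V, hV, hVh⟩ := exists_nhds_one_abs_sub_lt hK hhc (by positivity : 0 < δ / 4)
  set A : Set (CosetSpace Γ) := {x | δ / 4 ≤ ‖f x - h x‖}
  have hAm : MeasurableSet A := measurableSet_le measurable_const (hf.sub hhc.measurable).norm
  have hAμ : μ.real A ≤ ε / 8 := by
    have := (mul_meas_ge_le_integral_of_nonneg (.of_forall fun x => norm_nonneg (f x - h x))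
      (hfi.sub hhi).norm (δ / 4)).trans hfh
    exact le_of_mul_le_mul_right (by linarith) (by positivity : 0 < δ / 4)
  have hKμ' : μ.real Kᶜ < ε / 8 := by
    rw [compl_eq_univ_sdiff]
    have := (ENNReal.lt_ofReal_iff_toReal_lt (measure_ne_top _ _)).1 hKμ
    rw [measureReal_def]
    linarith
  have hKm : MeasurableSet Kᶜ := hK.measurableSet.compl
  have hAK : μ.real (A ∪ Kᶜ) < ε / 4 := (measureReal_union_le _ _).trans_lt (by linarith)
  refine ⟨{x | |f (horocycleFlow Γ 1 x) - f x| ≤ δ} ∪ (A ∪ Kᶜ) ∪ horocycleFlow Γ 1 ⁻¹' (A ∪ Kᶜ),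
    ((measurableSet_le hDm measurable_const).union (hAm.union hKm)).union
      (hTmp.measurable (hAm.union hKm)), ?_, V, hV, fun x hx g hg hy => ?_⟩
  · have h1 : μ.real (horocycleFlow Γ 1 ⁻¹' (A ∪ Kᶜ)) = μ.real (A ∪ Kᶜ) := by
      rw [measureReal_def, hTmp.measure_preimage (hAm.union hKm).nullMeasurableSet, measureReal_def]
    refine (measureReal_union_le _ _).trans_lt ?_
    have := measureReal_union_le (μ := μ) {x | |f (horocycleFlow Γ 1 x) - f x| ≤ δ} (A ∪ Kᶜ)
    linarith
  · simp only [mem_union, mem_compl_iff, mem_preimage, not_or, not_not, mem_ofPred_eq, A,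
      not_le, Real.norm_eq_abs] at hx hy
    obtain ⟨⟨hxD, -⟩, hTx, hTxK⟩ := hx
    have h1 := hVh _ hTxK g hg
    have h2 := hy.1.2.1
    -- With `y` the translate of `η_1 x` by `g`, the values `f y`, `h y`, `h (η_1 x)`, `f (η_1 x)`
    -- are successively within `δ / 4`. So `f y = f x` would put `f (η_1 x)` within `δ` of `f x`,
    -- and `x` in `B`.
    intro heq
    rw [heq] at h2
    refine hxD.not_ge ?_
    rw [abs_lt] at hTx h1 h2
    rw [abs_le]
    constructor <;> linarith

end Factor

/-! ### Occupation times of horocycle orbits -/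

section Occupation

lemma intervalIntegrable_indicator_one {A : Set ℝ} (hA : MeasurableSet A) (a b : ℝ) :
    IntervalIntegrable (A.indicator fun _ => (1 : ℝ)) volume a b := by
  rw [intervalIntegrable_iff]
  exact (intervalIntegrable_iff.1 intervalIntegrable_const).indicator hA

/-- Two sets of small total measure in an interval leave room for a generic time. -/
lemma exists_mem_Icc_notMem_of_integral_lt {A₁ A₂ : Set ℝ} (h₁ : MeasurableSet A₁)
    (h₂ : MeasurableSet A₂) {P : ℝ → Prop} (hP : ∀ᵐ t, P t) {a b : ℝ} (hab : a ≤ b)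
    (h : (∫ t in a..b, A₁.indicator (fun _ => (1 : ℝ)) t) +
      ∫ t in a..b, A₂.indicator (fun _ => (1 : ℝ)) t < b - a) :
    ∃ t ∈ Icc a b, t ∉ A₁ ∧ t ∉ A₂ ∧ P t := by
  by_contra! hcon
  refine h.not_ge ?_
  rw [← intervalIntegral.integral_add (intervalIntegrable_indicator_one h₁ a b)
    (intervalIntegrable_indicator_one h₂ a b)]
  calc b - a = ∫ t in a..b, (1 : ℝ) := by simp
    _ ≤ _ := intervalIntegral.integral_mono_ae_restrict hab intervalIntegrable_const
      ((intervalIntegrable_indicator_one h₁ a b).add (intervalIntegrable_indicator_one h₂ a b)) ?_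
  filter_upwards [ae_restrict_mem measurableSet_Icc, ae_restrict_of_ae hP] with t ht hPt
  by_cases ht1 : t ∈ A₁
  · simp [ht1, indicator_nonneg]
  · have ht2 : t ∈ A₂ := by
      by_contra ht2
      exact hcon t ht ht1 ht2 hPt
    simp [ht2, indicator_nonneg]

variable {Γ : Subgroup SL(2, ℝ)} {μ : Measure (CosetSpace Γ)}

/-- The set of times at which the horocycle orbit of `x` is in `B`. -/
def visitTimes (B : Set (CosetSpace Γ)) (x : CosetSpace Γ) : Set ℝ :=
  {t | horocycleFlow Γ t x ∈ B}

/-- The time that the horocycle orbit of `x` spends in `B` up to time `a`. -/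
noncomputable def occupation (B : Set (CosetSpace Γ)) (x : CosetSpace Γ) (a : ℝ) : ℝ :=
  ∫ t in 0..a, (visitTimes B x).indicator (fun _ => 1) t

lemma measurableSet_visitTimes {B : Set (CosetSpace Γ)} (hB : MeasurableSet B)
    (x : CosetSpace Γ) : MeasurableSet (visitTimes B x) :=
  (continuous_horocycleFlow_uncurry.comp (Continuous.prodMk_right x)).measurable hB

lemma integral_visitTimes {B : Set (CosetSpace Γ)} (hB : MeasurableSet B) (x : CosetSpace Γ)
    (a b : ℝ) : ∫ t in a..b, (visitTimes B x).indicator (fun _ => (1 : ℝ)) t =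
      occupation B x b - occupation B x a :=
  (intervalIntegral.integral_interval_sub_left
    (intervalIntegrable_indicator_one (measurableSet_visitTimes hB x) _ _)
    (intervalIntegrable_indicator_one (measurableSet_visitTimes hB x) _ _)).symm

lemma occupation_mono {B : Set (CosetSpace Γ)} (hB : MeasurableSet B) (x : CosetSpace Γ) :
    Monotone (occupation B x) := by
  intro a b hab
  rw [← sub_nonneg, ← integral_visitTimes hB]
  exact intervalIntegral.integral_nonneg hab fun t _ => indicator_nonneg (fun _ _ => one_pos.le) t

lemma occupation_nonneg {B : Set (CosetSpace Γ)} (x : CosetSpace Γ) {a : ℝ} (ha : 0 ≤ a) :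
    0 ≤ occupation B x a :=
  intervalIntegral.integral_nonneg ha fun t _ => indicator_nonneg (fun _ _ => one_pos.le) t

lemma occupation_horocycleFlow {B : Set (CosetSpace Γ)} (hB : MeasurableSet B)
    (x : CosetSpace Γ) (s a : ℝ) :
    occupation B (horocycleFlow Γ s x) a = occupation B x (s + a) - occupation B x s := by
  have h := intervalIntegral.integral_comp_add_left (a := 0) (b := a)
    ((visitTimes B x).indicator fun _ => (1 : ℝ)) s
  rw [add_zero, integral_visitTimes hB] at h
  rw [← h, occupation]
  refine intervalIntegral.integral_congr fun t _ => ?_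
  have : t ∈ visitTimes B (horocycleFlow Γ s x) ↔ s + t ∈ visitTimes B x := by
    change _ ∈ B ↔ _ ∈ B
    rw [horocycleFlow_add]
  by_cases h : s + t ∈ visitTimes B x
  · simp only [indicator_of_mem h, indicator_of_mem (this.2 h)]
  · simp only [indicator_of_notMem h, indicator_of_notMem (mt this.1 h)]

/-- This reduces equidistribution in continuous time to the ergodic theorem for the time-one map. -/
lemma birkhoffSum_occupation {B : Set (CosetSpace Γ)} (hB : MeasurableSet B)
    (x : CosetSpace Γ) (n : ℕ) :
    birkhoffSum (horocycleFlow Γ 1) (fun y => occupation B y 1) n x = occupation B x n := by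
  induction n with
  | zero => simp [occupation]
  | succ n ih =>
    rw [birkhoffSum_succ, ih, iterate_horocycleFlow_one, occupation_horocycleFlow hB]
    push_cast
    ring

lemma measurable_indicator_horocycleFlow {B : Set (CosetSpace Γ)} (hB : MeasurableSet B) :
    Measurable fun p : CosetSpace Γ × ℝ => (visitTimes B p.1).indicator (fun _ => (1 : ℝ)) p.2 :=
  measurable_const.indicator (continuous_horocycleFlow_uncurry.measurable hB)

lemma measurable_occupation {B : Set (CosetSpace Γ)} (hB : MeasurableSet B) {a : ℝ}
    (ha : 0 ≤ a) : Measurable fun x => occupation B x a := by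
  simp only [occupation, intervalIntegral.integral_of_le ha]
  exact ((measurable_indicator_horocycleFlow hB).stronglyMeasurable.integral_prod_right'
    (ν := volume.restrict (Ioc 0 a))).measurable

lemma integrable_occupation_one (hμ : IsHaarProbability Γ μ) {B : Set (CosetSpace Γ)}
    (hB : MeasurableSet B) : Integrable (fun x => occupation B x 1) μ ∧
      ∫ x, occupation B x 1 ∂μ = μ.real B := by
  have := hμ.isProbabilityMeasure
  have hprod : Integrable (fun p : CosetSpace Γ × ℝ =>
      (visitTimes B p.1).indicator (fun _ => (1 : ℝ)) p.2) (μ.prod (volume.restrict (Ioc 0 1))) :=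
    .of_bound (measurable_indicator_horocycleFlow hB).aestronglyMeasurable 1 (.of_forall fun p => by
      simp only [indicator]
      split_ifs <;> simp)
  simp only [occupation, intervalIntegral.integral_of_le zero_le_one]
  refine ⟨hprod.integral_prod_left, ?_⟩
  rw [integral_integral_swap hprod]
  have (t : ℝ) : ∫ x, (visitTimes B x).indicator (fun _ => (1 : ℝ)) t ∂μ = μ.real B := by
    have h1 : (fun x => (visitTimes B x).indicator (fun _ => (1 : ℝ)) t) =
      (horocycleFlow Γ t ⁻¹' B).indicator fun _ => 1 := rfl
    have hmp : MeasurePreserving (horocycleFlow Γ t) μ μ := hμ.invariant _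
    rw [h1, integral_indicator (hmp.measurable hB)]
    simp [measureReal_def, hmp.measure_preimage hB.nullMeasurableSet]
  simp [this]

lemma ae_eventually_abs_occupation_sub_le (hΓ : DiscreteTopology Γ) (hμ : IsHaarProbability Γ μ)
    {B : Set (CosetSpace Γ)} (hB : MeasurableSet B) {ε : ℝ} (hε : 0 < ε) :
    ∀ᵐ x ∂μ, ∀ᶠ n : ℕ in atTop, |occupation B x n - μ.real B * n| ≤ ε * n := by
  have := hμ.isProbabilityMeasure
  obtain ⟨hi, hint⟩ := integrable_occupation_one hμ hB
  simpa only [birkhoffSum_occupation hB, hint] using ae_eventually_abs_birkhoffSum_sub_le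
    (ergodic_horocycleFlow_one hΓ hμ) (measurable_occupation hB zero_le_one) hi hε

end Occupation

/-! ### Equivariance along almost every orbit -/

section Equivariance

variable {Γ : Subgroup SL(2, ℝ)} {μ : Measure (CosetSpace Γ)} {Ω : Type*} [MeasurableSpace Ω]
  {ν : Measure Ω} {φ : ℝ → Ω → Ω} {ψ : CosetSpace Γ → Ω}

/-- The exceptional null set depends on `t`; Fubini exchanges the quantifiers. -/
lemma ae_ae_apply_horocycleFlow_eq [StandardBorelSpace Ω] (hμ : IsHaarProbability Γ μ)
    (hφ : IsMeasurePreservingFlow φ ν) (hψ : IsQuotientMap (horocycleFlow Γ) μ φ ν ψ) :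
    ∀ᵐ x ∂μ, ∀ᵐ t : ℝ, ψ (horocycleFlow Γ t x) = φ t (ψ x) := by
  have := hμ.isProbabilityMeasure
  have hψm := hψ.measurePreserving.measurable
  refine (Measure.ae_ae_comm (μ := μ) (ν := (volume : Measure ℝ))
    (p := fun x t => ψ (horocycleFlow Γ t x) = φ t (ψ x)) (measurableSet_eq_fun
      (hψm.comp continuous_horocycleFlow_uncurry.measurable)
      (hφ.measurable.comp (measurable_snd.prodMk (hψm.comp measurable_fst))))).2
    (.of_forall fun t => hψ.equivariant t)

/-- The stabilizer of a point under a flow. -/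
def flowStabilizer (hφ : IsMeasurePreservingFlow φ ν) (ω : Ω) : AddSubgroup ℝ where
  carrier := {t | φ t ω = ω}
  zero_mem' := by simp [hφ.map_zero]
  add_mem' {s t} hs ht := by
    change φ (s + t) ω = ω
    rw [hφ.map_add, Function.comp_apply, ht, hs]
  neg_mem' {t} ht := by
    change φ (-t) ω = ω
    have := congrFun (hφ.map_add (-t) t) ω
    rw [neg_add_cancel, hφ.map_zero, Function.comp_apply, ht] at this
    exact this.symm

/-- If two generic points of an orbit are in the same fiber, then so are almost all pairs of points
of the orbit with displacement a multiple of the original one. -/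
lemma ae_apply_horocycleFlow_zsmul_eq (hφ : IsMeasurePreservingFlow φ ν) {x : CosetSpace Γ} {s : ℝ}
    (hx : ∀ᵐ t : ℝ, ψ (horocycleFlow Γ t x) = φ t (ψ x))
    (hy : ∀ᵐ t : ℝ, ψ (horocycleFlow Γ t (horocycleFlow Γ s x)) = φ t (ψ (horocycleFlow Γ s x)))
    (heq : ψ (horocycleFlow Γ s x) = ψ x) (k : ℤ) :
    ∀ᵐ t : ℝ, ψ (horocycleFlow Γ (k * s + t) x) = ψ (horocycleFlow Γ t x) := by
  have hshift (r : ℝ) : ∀ᵐ t : ℝ, ψ (horocycleFlow Γ (r + t) x) = φ (r + t) (ψ x) :=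
    (measurePreserving_add_left volume r).quasiMeasurePreserving.ae hx
  -- Equivariance may fail at time `s` itself. A `t` generic for both points gives `φ_{s+t} (ψ x) =
  -- φ_t (ψ x)`, and `φ_t` cancels.
  have hs : s ∈ flowStabilizer hφ (ψ x) := by
    obtain ⟨t, h1, h2⟩ := ((hshift s).and hy).exists
    rw [horocycleFlow_add, h2, heq, add_comm] at h1
    have h3 (r : ℝ) (ω : Ω) : φ (-r) (φ r ω) = ω := by
      have := congrFun (hφ.map_add (-r) r) ω
      rw [neg_add_cancel, hφ.map_zero] at this
      exact this.symm
    rw [hφ.map_add, Function.comp_apply] at h1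
    have h4 := congrArg (φ (-t)) h1
    rw [h3, h3] at h4
    exact h4.symm
  have hk : k * s ∈ flowStabilizer hφ (ψ x) := by simpa using zsmul_mem hs k
  replace hk : φ (k * s) (ψ x) = ψ x := hk
  filter_upwards [hx, hshift (k * s)] with t h1 h2
  rw [h1, h2, add_comm, hφ.map_add, Function.comp_apply, hk]

end Equivariance

/-! ### Incompatibility of drift and equal images -/

section FiniteFibers

variable {Γ : Subgroup SL(2, ℝ)} {μ : Measure (CosetSpace Γ)} {Ω : Type*} {ψ : CosetSpace Γ → Ω}

/-- Two orbits with almost everywhere the same image cannot have displacement close to `u ^ 1`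
during an interval of time most of which they spend outside `B`. -/
lemma false_of_displacement_near_one {B : Set (CosetSpace Γ)} (hB : MeasurableSet B)
    {V : Set SL(2, ℝ)}
    (hsep : ∀ x ∉ B, ∀ g ∈ V, rightTranslate Γ g (horocycleFlow Γ 1 x) ∉ B →
      ψ (rightTranslate Γ g (horocycleFlow Γ 1 x)) ≠ ψ x)
    {x : CosetSpace Γ} {g : SL(2, ℝ)}
    (hψ : ∀ᵐ t : ℝ, ψ (horocycleFlow Γ t (rightTranslate Γ g x)) = ψ (horocycleFlow Γ t x))
    {a b : ℝ} (hab : a ≤ b) (hg : ∀ t ∈ Icc a b, unip (-1) * (unip (-t) * g * unip t) ∈ V)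
    (hocc : occupation B x b - occupation B x a + (occupation B (rightTranslate Γ g x) b -
      occupation B (rightTranslate Γ g x) a) < b - a) : False := by
  rw [← integral_visitTimes hB, ← integral_visitTimes hB] at hocc
  obtain ⟨t, ht, h1, h2, h3⟩ := exists_mem_Icc_notMem_of_integral_lt
    (measurableSet_visitTimes hB _) (measurableSet_visitTimes hB _) hψ hab hocc
  have hy : rightTranslate Γ (unip (-1) * (unip (-t) * g * unip t))
      (horocycleFlow Γ 1 (horocycleFlow Γ t x)) = horocycleFlow Γ t (rightTranslate Γ g x) := by
    have hcancel (r : ℝ) : unip r * unip (-r) = 1 := by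
      rw [← unip_add, add_neg_cancel, unip_zero]
    simp only [horocycleFlow, ← rightTranslate_mul]
    congr 1
    rw [mul_assoc (unip t), ← mul_assoc (unip 1), hcancel, one_mul, mul_assoc, ← mul_assoc (unip t),
      hcancel, one_mul]
  refine hsep _ h1 _ (hg t ht) ?_ ?_
  · rw [hy]; exact h2
  · rw [hy]; exact h3

/-- Let `L` be the length of the integer window. Rounding costs at most `2 ≤ c T / 2`, so `L ≥ c T /
2`. Each function grows by at most `L / 8 + c T / 16 ≤ L / 4`, and the two together by at most `L /
2`. -/
lemma sub_add_sub_lt_of_abs_sub_le {N : ℕ} {β κ c T : ℝ} {F G : ℕ → ℝ} (hβ : β < 1 / 8)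
    (hc : 0 < c) (hκ : κ = c / 32) (hN : N ≤ (1 - c) * T) (hT : 4 / c ≤ T)
    (hF : ∀ n ≥ N, |F n - β * n| ≤ κ * n) (hG : ∀ n ≥ N, |G n - β * n| ≤ κ * n) :
    ((⌈(1 - c) * T⌉₊ : ℕ) : ℝ) ≤ ⌊T⌋₊ ∧ F ⌊T⌋₊ - F ⌈(1 - c) * T⌉₊ +
      (G ⌊T⌋₊ - G ⌈(1 - c) * T⌉₊) < (⌊T⌋₊ : ℝ) - ⌈(1 - c) * T⌉₊ := by
  have hT0 : 0 < T := lt_of_lt_of_le (by positivity) hT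
  have hcT : 4 ≤ c * T := by rwa [div_le_iff₀' hc] at hT
  have h0 : 0 ≤ (1 - c) * T := (Nat.cast_nonneg N).trans hN
  have h1 := Nat.ceil_lt_add_one h0
  have h2 := Nat.lt_floor_add_one T
  have h3 := Nat.floor_le hT0.le
  have hNceil : N ≤ ⌈(1 - c) * T⌉₊ := by exact_mod_cast hN.trans (Nat.le_ceil _)
  set n₁ := ⌈(1 - c) * T⌉₊
  set n₂ := ⌊T⌋₊
  have hlen : c * T / 2 ≤ (n₂ : ℝ) - n₁ := by linarith
  have hle : (n₁ : ℝ) ≤ n₂ := by linarith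
  have hNfloor : N ≤ n₂ := hNceil.trans (by exact_mod_cast hle)
  refine ⟨hle, ?_⟩
  have hκn : κ * n₁ + κ * n₂ ≤ c * T / 16 := by
    rw [← mul_add, hκ]
    have : (n₁ : ℝ) + n₂ ≤ 2 * T := by linarith
    nlinarith
  have hβn : β * ((n₂ : ℝ) - n₁) ≤ 1 / 8 * ((n₂ : ℝ) - n₁) :=
    mul_le_mul_of_nonneg_right hβ.le (by linarith)
  have hF1 := (abs_le.1 (hF n₁ hNceil)).1
  have hF2 := (abs_le.1 (hF n₂ hNfloor)).2
  have hG1 := (abs_le.1 (hG n₁ hNceil)).1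
  have hG2 := (abs_le.1 (hG n₂ hNfloor)).2
  have : 0 < c * T := by linarith
  linarith

end FiniteFibers

end Horocycle

theorem mainTheorem7 (Γ : Subgroup SL(2, ℝ)) (hΓ : Horocycle.IsLattice Γ)
    (μ : Measure (Horocycle.CosetSpace Γ)) (hμ : Horocycle.IsHaarProbability Γ μ)
    {Ω : Type*} [MeasurableSpace Ω] [StandardBorelSpace Ω]
    (ν : Measure Ω) [IsProbabilityMeasure ν]
    (φ : ℝ → Ω → Ω) (hφ : Horocycle.IsMeasurePreservingFlow φ ν)
    (ψ : Horocycle.CosetSpace Γ → Ω)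
    (hψ : Horocycle.IsQuotientMap (Horocycle.horocycleFlow Γ) μ φ ν ψ)
    (hν : ¬ Horocycle.IsTrivialSpace ν) :
    Horocycle.HasFiniteFibersAE μ ψ := by
  open Horocycle Set Filter Topology in
  have hd := hΓ.discrete
  have := hμ.isProbabilityMeasure
  have := t2Space_cosetSpace Γ hd
  have := regular_of_isHaarProbability hd hμ
  have hψm := hψ.measurePreserving.measurable
  have he := measurableEmbedding_sigmoid_comp_embeddingReal Ω
  -- A bounded injective encoding of `Ω` makes the factor map integrable without merging fibers.
  set e : Ω → ℝ := fun ω => (unitInterval.sigmoid ∘ embeddingReal Ω) ω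
  have hem : Measurable e := measurable_subtype_coe.comp he.measurable
  have hei : Function.Injective e := Subtype.val_injective.comp he.injective
  have he01 (ω : Ω) : e ω ∈ Icc (0 : ℝ) 1 := (unitInterval.sigmoid (embeddingReal Ω ω)).2
  have hfm : Measurable fun x => e (ψ x) := hem.comp hψm
  have hfi : Integrable (fun x => e (ψ x)) μ :=
    .of_bound hfm.aestronglyMeasurable 1 (.of_forall fun x => by
      rw [Real.norm_eq_abs, abs_of_nonneg (he01 _).1]
      exact (he01 _).2)
  obtain ⟨B, hB, hBμ, V, hV, hsep⟩ := exists_small_set_of_ae_ne hd hμ hfm hfi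
    ((ae_apply_horocycleFlow_one_ne hd hμ hφ hψ hν).mono fun x hx => hei.ne hx)
    (by norm_num : (0 : ℝ) < 1 / 8)
  replace hsep : ∀ x ∉ B, ∀ g ∈ V, rightTranslate Γ g (horocycleFlow Γ 1 x) ∉ B →
      ψ (rightTranslate Γ g (horocycleFlow Γ 1 x)) ≠ ψ x :=
    fun x hx g hg hy => ne_of_apply_ne e (hsep x hx g hg hy)
  obtain ⟨c, ⟨hc0, hc1⟩, hshear⟩ := exists_shear hV
  set κ := c / 32 with hκ
  obtain ⟨X₁, hX₁, hX₁m, hX₁p⟩ := ((ae_ae_apply_horocycleFlow_eq hμ hφ hψ).and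
    (ae_eventually_abs_occupation_sub_le hd hμ hB (by positivity : 0 < κ))).exists_measurable_mem
  -- One threshold `N` must serve all points of `K`, since `W` is chosen after `N` and before the
  -- points.
  set G : ℕ → Set (CosetSpace Γ) := fun N =>
    X₁ ∩ ⋂ n ≥ N, {x | |occupation B x n - μ.real B * n| ≤ κ * n} with hG
  have hGm (N : ℕ) : MeasurableSet (G N) :=
    hX₁m.inter (.iInter fun n => .iInter fun _ => measurableSet_le
      ((measurable_occupation hB n.cast_nonneg).sub_const _).norm measurable_const)
  obtain ⟨N, hN⟩ : ∃ N, μ (G N) ≠ 0 := by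
    by_contra! h
    have h1 : ∀ᵐ x ∂μ, ∀ N, x ∉ G N := ae_all_iff.2 fun N => measure_eq_zero_iff_ae_notMem.1 (h N)
    obtain ⟨x, hx1, hx2⟩ := (h1.and hX₁).exists
    obtain ⟨N, hN⟩ := eventually_atTop.1 (hX₁p x hx2).2
    exact hx1 N ⟨hx2, mem_iInter₂.2 hN⟩
  obtain ⟨K, hKG, hK, hK0⟩ := (hGm N).exists_lt_isCompact_of_ne_top (measure_ne_top _ _)
    (pos_iff_ne_zero.2 hN)
  have hKae (x) (hx : x ∈ K) : ∀ᵐ t : ℝ, ψ (horocycleFlow Γ t x) = φ t (ψ x) :=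
    (hX₁p x (hKG hx).1).1
  have hKocc (x) (hx : x ∈ K) : ∀ n ≥ N, |occupation B x n - μ.real B * n| ≤ κ * n :=
    mem_iInter₂.1 (hKG hx).2
  obtain ⟨W, hW, hWg⟩ := hshear (max (N / (1 - c)) (4 / c))
  obtain ⟨M, hM⟩ := exists_card_le_of_separated hK hW
  refine hasFiniteFibersAE_of_card_le (ergodic_horocycleFlow_one hd hμ)
    (rightTranslate_injective _) (hψ.equivariant 1) hK.measurableSet hK0.ne' (N := M)
    fun F hFK hFψ => hM F hFK fun x hx g hg hy => ?_
  by_contra hne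
  have hg1 : g ≠ 1 := by
    rintro rfl
    exact hne (rightTranslate_one x)
  have hxK := hFK hx
  have hyK := hFK hy
  have hψxy : ∀ᵐ t : ℝ, ψ (horocycleFlow Γ t (rightTranslate Γ g x)) =
      ψ (horocycleFlow Γ t x) := by
    filter_upwards [hKae _ hxK, hKae _ hyK] with t h1 h2
    rw [h1, h2, hFψ _ hx _ hy]
  rcases hWg g hg hg1 with ⟨s, k, rfl, hks, hksV⟩ | ⟨T, hT, hconj⟩
  · have hae := ae_apply_horocycleFlow_zsmul_eq hφ (hKae x hxK) (hKae _ hyK) (hFψ _ hy _ hx) k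
    simp only [horocycleFlow_add] at hae
    -- The point `η_{ks} x` need not be in `K`, but as `0 ≤ ks ≤ 2` its visits up to time `N + 4`
    -- are visits of `x` up to `N + 6`. The total is at most `(2 N + 10) / 6 < N + 4`.
    refine false_of_displacement_near_one hB hsep hae (Nat.cast_nonneg (N + 4)) (fun t _ => ?_) ?_
    · rw [← unip_add, ← unip_add, ← unip_add]
      convert hksV using 2
      ring
    · have h1 := (abs_le.1 (hKocc x hxK (N + 4) (by omega))).2
      have h2 := (abs_le.1 (hKocc x hxK (N + 4 + 2) (by omega))).2
      have h3 := occupation_horocycleFlow hB x (k * s) ((N + 4 : ℕ) : ℝ)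
      have h4 : occupation B x (k * s + ((N + 4 : ℕ) : ℝ)) ≤
          occupation B x ((N + 4 + 2 : ℕ) : ℝ) := by
        refine occupation_mono hB x ?_
        push_cast
        linarith [hks.2]
      have h5 := occupation_nonneg (B := B) x hks.1
      have h6 := occupation_nonneg (B := B) x le_rfl
      have h7 := occupation_nonneg (B := B) (horocycleFlow Γ (k * s) x) le_rfl
      have h8 : μ.real B + κ ≤ 1 / 6 := by linarith
      have h9 : 0 ≤ (N : ℝ) := N.cast_nonneg
      have h10 : (μ.real B + κ) * N ≤ 1 / 6 * N := mul_le_mul_of_nonneg_right h8 h9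
      change _ + (occupation B (horocycleFlow Γ (k * s) x) _ -
        occupation B (horocycleFlow Γ (k * s) x) _) < _
      push_cast at *
      linarith
  · have hT1 : N ≤ (1 - c) * T := by
      have := (le_max_left _ _).trans hT
      rwa [div_le_iff₀' (by linarith)] at this
    have hT2 : 4 / c ≤ T := (le_max_right _ _).trans hT
    have hT0 : 0 ≤ T := le_trans (by positivity) hT2
    have hsub : Icc ((⌈(1 - c) * T⌉₊ : ℕ) : ℝ) ⌊T⌋₊ ⊆ Icc ((1 - c) * T) T :=
      Icc_subset_Icc (Nat.le_ceil _) (Nat.floor_le hT0)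
    rcases hconj with hconj | hconj
    · obtain ⟨hle, hlt⟩ := sub_add_sub_lt_of_abs_sub_le hBμ hc0 hκ hT1 hT2
        (hKocc x hxK) (hKocc _ hyK)
      exact false_of_displacement_near_one hB hsep hψxy hle (fun t ht => hconj t (hsub ht)) hlt
    · have hxy : rightTranslate Γ g⁻¹ (rightTranslate Γ g x) = x := by
        rw [← rightTranslate_mul, mul_inv_cancel, rightTranslate_one]
      obtain ⟨hle, hlt⟩ := sub_add_sub_lt_of_abs_sub_le hBμ hc0 hκ hT1 hT2
        (hKocc _ hyK) (hKocc x hxK)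
      refine false_of_displacement_near_one (x := rightTranslate Γ g x) (g := g⁻¹) hB hsep ?_ hle
        (fun t ht => hconj t (hsub ht)) ?_
      · rw [hxy]
        exact hψxy.mono fun t ht => ht.symm
      · rwa [hxy]
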